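/- A \emph{$1$-PS} is a tuple $\mathcal N=(Q,\Sigma,\Delta,q_0)$ with finite sets $Q$ (states) and $\Sigma$ (stack alphabet), a distinguished symbol $\bot\in\Sigma$, $q_0\in Q$, and $\Delta\subseteq Q\times\Sigma\times Q\times \mathrm{Op}$, where $\mathrm{Op}$ consists of $\mathrm{push}_\sigma$ ($\sigma\in\Sigma\setminus\{\bot\}$), which appends $\sigma$ to a stack $w\in\Sigma^+$, and $\mathrm{pop}$, which removes the last (topmost) letter and is undefined on one-letter stacks. Put $|\mathcal N|:=|Q|+|\Sigma|+|\Delta|$. Configurations are pairs $(q,w)\in Q\times\Sigma^+$, and $(q,w)\to^{\delta}(q',w')$ for $\delta=(q,\sigma,q',op)\in\Delta$ if $\sigma$ is the topmost letter of $w$ and $op(w)=w'$. A run is a finite sequence $c_0\to^{\delta_1}c_1\to^{\delta_2}\cdots\to^{\delta_m}c_m$; its length is $m$. Let $\mathfrak N$ be the set of runs of $\mathcal N$ starting in $(q_0,\bot)$. Write $\preceq$ for the initial segment relation on runs, $\prec$ for the proper one, and $|\rho|$ for the number of letters of the final stack of $\rho$. For $\rho_1,\rho_2\in\mathfrak N$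 let \begin{itemize} \item $\rho_1\to^{\delta}\rho_2$ if $\rho_2$ extends $\rho_1$ by the single transition $\delta$; \item $\rho_1\curvearrowright\rho_2$ (jump edge) if $\rho_2=\rho_1\circ\rho$ for a run $\rho$ of length $m\ge 2$ that starts and ends with the same stack $s$, begins with a push, ends with a pop, and whose configurations $\rho(i)$, $1\le i<m$, do not have stack $s$; \item $\rho_1\to^{+1}\rho_2$ if $\rho_1\prec\rho_2$, $|\rho_1|=|\rho_2|-1$, and $|\pi|>|\rho_1|$ for all $\rho_1\prec\pi\prec\rho_2$. \end{itemize} The set of relevant $l$-ancestors of $\rho\in\mathfrak N$ is given by $RA_0(\rho)=\{\rho\}$ and \[RA_{l+1}(\rho)=RA_l(\rho)\cup\{\pi\in\mathfrak N : \exists \pi'\in RA_l(\rho)\ (\pi\to^\delta\pi'\text{ for some }\delta\in\Delta,\text{ or }\pi\curvearrowright\pi',\text{ or }\pi\to^{+1}\pi')\},\] and $RA_l(\rho_1,\dots,\rho_n)=\bigcup_i RA_l(\rho_i)$. For $n$-tuples $\bar\rho,\bar\rho'$ of elements of $\mathfrak N$ write $\bar\rho\approx_l\bar\rho'$ if there is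 a bijection $\varphi:RA_l(\bar\rho)\to RA_l(\bar\rho')$ such that \begin{enumerate} \item for all $k\le l$, all $i$ and all $\pi\in RA_l(\bar\rho)$ with $\pi\in RA_k(\rho_i)$, we have $\varphi(\pi)\in RA_k(\rho'_i)$; \item for all $\pi_1,\pi_2\in RA_l(\bar\rho)$ there is a $\to^\delta$-edge ($\delta\in\Delta$), a $\curvearrowright$-edge or a $\to^{+1}$-edge, respectively, from $\pi_1$ to $\pi_2$ if and only if there is one of the same kind from $\varphi(\pi_1)$ to $\varphi(\pi_2)$; \item $\pi$ and $\varphi(\pi)$ have the same final state and the same topmost letter of the final stack, for all $\pi\in RA_l(\bar\rho)$. \end{enumerate} \textbf{Proposition.} There is a polynomial $p$ such that the following holds for every $1$-PS $\mathcal N$. Let $l',C,n\in\mathbb N$ with $n\ge 1$, and $l:=4l'+5$. Let $\bar\rho$ and $\bar\rho'$ be $n$-tuples of elements of $\mathfrak N$ such that $\bar\rho\approx_l\bar\rho'$ and every $\pi\in RA_l(\bar\rho')$ has length at most $C$. Then for each $\rho\in\mathfrak N$ there is some $\rho'\in\mathfrak N$ such that $\bar\rho,\rho\approx_{l'}\bar\rho',\rho'$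 and every $\pi\in RA_{l'}(\bar\rho',\rho')$ has length at most \[C+4^{l'}\cdot n\cdot 4^{l}\cdot\exp(p(|\mathcal N|)).\] -/

import Mathlib

namespace NestedPushdown

/-- Level 1 stacks over `Γ`: nonempty words. The head of the list is the topmost letter. -/
abbrev Stack (Γ : Type*) := {w : List Γ // w ≠ []}

/-- The topmost letter of a stack. -/
def Stack.top {Γ : Type*} (s : Stack Γ) : Γ := s.1.head s.2

/-- The width `|s|` of a level 1 stack, i.e. its number of letters. -/
def Stack.width {Γ : Type*} (s : Stack Γ) : ℕ := s.1.length

/-- The level 1 stack operations. -/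
inductive StackOp (Γ : Type*) where
  | push (σ : Γ)
  | pop

/-- The partial function on stacks given by an operation: `push σ` writes `σ` on top, and `pop`
removes the topmost letter and is undefined on stacks with one letter. -/
def StackOp.apply {Γ : Type*} : StackOp Γ → Stack Γ → Option (Stack Γ)
  | .push σ, s => some ⟨σ :: s.1, List.cons_ne_nil _ _⟩
  | .pop, ⟨_ :: b :: w, _⟩ => some ⟨b :: w, List.cons_ne_nil _ _⟩
  | .pop, _ => none

/-- A transition `(q, σ, q', op)`. -/
structure Transition (Q Γ : Type*) where
  source : Q
  symbol : Γ
  target : Q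
  op : StackOp Γ

/-- A configuration: a state and a stack. -/
structure Config (Q Γ : Type*) where
  state : Q
  stack : Stack Γ

/-- Pushdown systems of level 1 (1-PS) with state set `Q` and stack alphabet `Γ`. The
bottom-of-stack symbol `bot` is never pushed. -/
structure OnePS (Q Γ : Type*) where
  bot : Γ
  init : Q
  trans : Finset (Transition Q Γ)
  push_ne_bot : ∀ δ ∈ trans, ∀ σ : Γ, δ.op = StackOp.push σ → σ ≠ bot

variable {Q Γ : Type*}

/-- The size of a 1-PS: the number of its states, stack symbols and transitions. -/
def OnePS.size [Fintype Q] [Fintype Γ] (N : OnePS Q Γ) : ℕ :=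
  Fintype.card Q + Fintype.card Γ + N.trans.card

/-- The initial configuration. -/
def OnePS.initConfig (N : OnePS Q Γ) : Config Q Γ :=
  ⟨N.init, ⟨[N.bot], List.cons_ne_nil _ _⟩⟩

/-- The relation `c →δ c'` on configurations. -/
def OnePS.Step (N : OnePS Q Γ) (δ : Transition Q Γ) (c c' : Config Q Γ) : Prop :=
  δ ∈ N.trans ∧ c.state = δ.source ∧ c.stack.top = δ.symbol ∧ c'.state = δ.target ∧
    δ.op.apply c.stack = some c'.stack

/-- The list `[(δ₁, c₁), …, (δₙ, cₙ)]` satisfies `c →δ₁ c₁ →δ₂ ⋯ →δₙ cₙ`. -/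
def OnePS.IsRun (N : OnePS Q Γ) : Config Q Γ → List (Transition Q Γ × Config Q Γ) → Prop
  | _, [] => True
  | c, (δ, c') :: r => N.Step δ c c' ∧ N.IsRun c' r

/-- Runs `c₀ →δ₁ c₁ →δ₂ ⋯ →δₙ cₙ`, stored as `start = c₀` and
`steps = [(δ₁, c₁), …, (δₙ, cₙ)]`. -/
structure Run (N : OnePS Q Γ) where
  start : Config Q Γ
  steps : List (Transition Q Γ × Config Q Γ)
  isRun : N.IsRun start steps

namespace Run

variable {N : OnePS Q Γ}

/-- The number of transitions of a run. -/
def length (ρ : Run N) : ℕ := ρ.steps.length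

/-- The `i`-th configuration `ρ(i)` of the run, for `0 ≤ i ≤ length ρ`. -/
def conf (ρ : Run N) (i : ℕ) : Config Q Γ :=
  (ρ.start :: ρ.steps.map Prod.snd).getD i ρ.start

/-- The final configuration of a run. -/
def last (ρ : Run N) : Config Q Γ := ρ.conf ρ.length

/-- `IsComp π ρ τ` says that `π ∘ ρ` is defined and equal to `τ`. -/
def IsComp (π ρ τ : Run N) : Prop :=
  π.last = ρ.start ∧ τ.start = π.start ∧ τ.steps = π.steps ++ ρ.steps

/-- `π` is an initial segment of `ρ`. -/
def Prefix (π ρ : Run N) : Prop := π.start = ρ.start ∧ π.steps <+: ρ.steps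

/-- `π` is a proper initial segment of `ρ`. -/
def StrictPrefix (π ρ : Run N) : Prop := π.Prefix ρ ∧ π ≠ ρ

/-- The width of the last stack of a run. -/
def width (ρ : Run N) : ℕ := ρ.last.stack.width

end Run

/-- The universe of the nested pushdown tree generated by `N`: the runs of `N` that start in the
initial configuration. -/
def NPT (N : OnePS Q Γ) := {ρ : Run N // ρ.start = N.initConfig}

namespace NPT

variable {N : OnePS Q Γ}

/-- The edge relation of the transition `δ`. -/
def Edge (δ : Transition Q Γ) (ρ₁ ρ₂ : NPT N) : Prop :=
  ∃ (ρ : Run N) (c : Config Q Γ), ρ.steps = [(δ, c)] ∧ Run.IsComp ρ₁.1 ρ ρ₂.1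

/-- The jump relation. -/
def Jump (ρ₁ ρ₂ : NPT N) : Prop :=
  ∃ ρ : Run N, Run.IsComp ρ₁.1 ρ ρ₂.1 ∧ 2 ≤ ρ.length ∧
    ρ.last.stack = ρ.start.stack ∧
    (∃ x ∈ ρ.steps.head?, ∃ σ : Γ, x.1.op = StackOp.push σ) ∧
    (∃ x ∈ ρ.steps.getLast?, x.1.op = StackOp.pop) ∧
    ∀ i : ℕ, 1 ≤ i → i < ρ.length → (ρ.conf i).stack ≠ ρ.start.stack

/-- The relation `+1`-edge: `ρ₁` is a proper ancestor of `ρ₂`, the final stack of `ρ₂` is wider by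
one, and all nodes strictly in between end in stacks wider than that of `ρ₁`. -/
def PlusEdge (ρ₁ ρ₂ : NPT N) : Prop :=
  ρ₁.1.StrictPrefix ρ₂.1 ∧ ρ₁.1.width + 1 = ρ₂.1.width ∧
    ∀ π : NPT N, ρ₁.1.StrictPrefix π.1 → π.1.StrictPrefix ρ₂.1 → ρ₁.1.width < π.1.width

/-- The set of relevant `l`-ancestors of a node. -/
def relAnc : ℕ → NPT N → Set (NPT N)
  | 0, ρ => {ρ}
  | l + 1, ρ => relAnc l ρ ∪
      {π | ∃ π' ∈ relAnc l ρ, (∃ δ ∈ N.trans, Edge δ π π') ∨ Jump π π' ∨ PlusEdge π π'}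

/-- The set of relevant `l`-ancestors of a tuple of nodes. -/
def relAncTuple (l : ℕ) {n : ℕ} (ρs : Fin n → NPT N) : Set (NPT N) := ⋃ i, relAnc l (ρs i)

/-- The relation `ρs ≈_l ρs'`: there is a bijection between the relevant `l`-ancestors which
respects the relevant `k`-ancestors of each component for `k ≤ l`, preserves (in both directions)
all three kinds of edges, and preserves final states and topmost stack symbols. -/
def AncEquiv (l : ℕ) {n : ℕ} (ρs ρs' : Fin n → NPT N) : Prop :=
  ∃ φ : relAncTuple l ρs ≃ relAncTuple l ρs',
    (∀ k ≤ l, ∀ (i : Fin n) (π : relAncTuple l ρs),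
      π.1 ∈ relAnc k (ρs i) → (φ π).1 ∈ relAnc k (ρs' i)) ∧
    (∀ δ ∈ N.trans, ∀ π π' : relAncTuple l ρs, Edge δ π.1 π'.1 ↔ Edge δ (φ π).1 (φ π').1) ∧
    (∀ π π' : relAncTuple l ρs, Jump π.1 π'.1 ↔ Jump (φ π).1 (φ π').1) ∧
    (∀ π π' : relAncTuple l ρs, PlusEdge π.1 π'.1 ↔ PlusEdge (φ π).1 (φ π').1) ∧
    (∀ π : relAncTuple l ρs, (φ π).1.1.last.state = π.1.1.last.state ∧
      (φ π).1.1.last.stack.top = π.1.1.last.stack.top)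

/-- The tuple `ρs, ρ`. -/
def extend {n : ℕ} (ρs : Fin n → NPT N) (ρ : NPT N) : Fin (n + 1) → NPT N :=
  Fin.snoc (α := fun _ => NPT N) ρs ρ

end NPT

end NestedPushdown

open NestedPushdown NestedPushdown.NPT

/-! A run from the initial configuration is determined by its word of transitions. Nodes are
therefore words ordered by the prefix relation, and the edges can be read off the stack widths along
these words (`plusEdge_iff_exec`, `jump_iff`). A node has at most one predecessor of each kind.
Which kinds exist is visible locally: a `+1`-predecessor exists iff the topmost letter is not the
bottom symbol, a jump predecessor iff the last transition pops. So a map that preserves labels,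
incoming edges and the run of length zero (`IsLocal`) also reflects edges as soon as it is injective
one level further out, and this yields the required equivalence (`IsLocal.ancEquiv`).

The relevant ancestors of `ρ` are prefixes of `ρ`, hence a chain. Edges do not cross, so neighbours
in this chain are joined by an edge (`par_of_consecutive`), and `ρ` can be copied node by node from
the bottom of the chain. While the chain stays inside the relevant `T`-ancestors of the old tuple,
the given bijection `φ` dictates the copy. At the first node outside, the copy has to avoid the
relevant `T`-ancestors of the second tuple. Such a copy exists by counting: if every admissible
continuation were forbidden, there would be finitely many of them, and pulling them back along `φ`
would be an injective, hence surjective, self-map of the admissible words, so the original node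
would be old as well (`NPT.exists_short_notMem`). Beyond that node any short copy of the joining
edge will do.

Short copies come from pumping. The runs along an edge with prescribed labels form a context-free
language with polynomially many nonterminals. A derived word can be shortened in steps of size at
most exponential in this number until it is a shortest one, so avoiding `k` words costs at most `k +
1` such steps (`Derives.exists_short_notMem`).

The copy and `φ` agree on the overlap, and new nodes stay away from old ones, because of the
distance estimate `relAnc_of_le`: if the chain meets the relevant `(l+1)`-ancestors of the tuple at
some node, then everything below that node in the chain is within `3(l+1)` levels of the tuple.
Hence `T = 3l+3`. -/

namespace NestedPushdown

/-! ### Configurations, steps, and runs that stay above a given width -/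

variable {Q Γ : Type*} {N : OnePS Q Γ}

/-- The configuration with state `q`, topmost letter `a`, and the letters `s` below. -/
def cfg (q : Q) (a : Γ) (s : List Γ) : Config Q Γ := ⟨q, ⟨a :: s, List.cons_ne_nil _ _⟩⟩

theorem exists_eq_cfg (c : Config Q Γ) : ∃ q a s, c = cfg q a s := by
  obtain ⟨q, ⟨w, hw⟩⟩ := c
  cases w with
  | nil => exact absurd rfl hw
  | cons a s => exact ⟨q, a, s, rfl⟩

@[simp] theorem cfg_state (q : Q) (a : Γ) (s : List Γ) : (cfg q a s).state = q := rfl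
@[simp] theorem cfg_top (q : Q) (a : Γ) (s : List Γ) : (cfg q a s).stack.top = a := rfl
@[simp] theorem cfg_width (q : Q) (a : Γ) (s : List Γ) :
    (cfg q a s).stack.width = s.length + 1 := rfl
@[simp] theorem cfg_stack (q : Q) (a : Γ) (s : List Γ) : (cfg q a s).stack.1 = a :: s := rfl

theorem cfg_inj {q q' : Q} {a a' : Γ} {s s' : List Γ} :
    cfg q a s = cfg q' a' s' ↔ q = q' ∧ a = a' ∧ s = s' := by
  simp [cfg]

theorem Stack.one_le_width (s : Stack Γ) : 1 ≤ s.width := List.length_pos_iff.2 s.2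

theorem step_iff {δ : Transition Q Γ} {c c' : Config Q Γ} :
    N.Step δ c c' ↔ δ ∈ N.trans ∧
      ((∃ b s, δ.op = .push b ∧ c = cfg δ.source δ.symbol s ∧
          c' = cfg δ.target b (δ.symbol :: s)) ∨
        ∃ b s, δ.op = .pop ∧ c = cfg δ.source δ.symbol (b :: s) ∧ c' = cfg δ.target b s) := by
  obtain ⟨q, ⟨w, hw⟩⟩ := c
  obtain ⟨q', ⟨w', hw'⟩⟩ := c'
  obtain ⟨p, a, p', op⟩ := δ
  rcases op with b | _
  · cases w with
    | nil => exact absurd rfl hw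
    | cons x w =>
      simp only [OnePS.Step, StackOp.apply, Stack.top, cfg, Config.mk.injEq, Option.some.injEq,
        Subtype.mk.injEq, List.head_cons, StackOp.push.injEq, reduceCtorEq, List.cons.injEq]
      constructor
      · rintro ⟨h, rfl, rfl, rfl, rfl⟩
        exact ⟨h, Or.inl ⟨b, w, rfl, ⟨rfl, rfl, rfl⟩, rfl, rfl⟩⟩
      · rintro ⟨h, ⟨b, s, rfl, ⟨rfl, rfl, rfl⟩, rfl, rfl⟩ | ⟨_, _, h', _⟩⟩
        · exact ⟨h, rfl, rfl, rfl, rfl⟩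
        · exact h'.elim
  · rcases w with _ | ⟨x, _ | ⟨y, w⟩⟩
    · exact absurd rfl hw
    · simp [OnePS.Step, StackOp.apply, cfg]
    · simp only [OnePS.Step, StackOp.apply, Stack.top, cfg, Config.mk.injEq, Option.some.injEq,
        Subtype.mk.injEq, List.head_cons, reduceCtorEq, List.cons.injEq]
      constructor
      · rintro ⟨h, rfl, rfl, rfl, rfl⟩
        exact ⟨h, Or.inr ⟨y, w, trivial, ⟨rfl, rfl, rfl, rfl⟩, rfl, rfl⟩⟩
      · rintro ⟨h, ⟨_, _, h', _⟩ | ⟨b, s, _, ⟨rfl, rfl, rfl, rfl⟩, rfl, rfl⟩⟩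
        · exact h'.elim
        · exact ⟨h, rfl, rfl, rfl, rfl⟩

theorem step_unique {δ : Transition Q Γ} {c c₁ c₂ : Config Q Γ} (h₁ : N.Step δ c c₁)
    (h₂ : N.Step δ c c₂) : c₁ = c₂ := by
  obtain ⟨q₁, w₁⟩ := c₁
  obtain ⟨q₂, w₂⟩ := c₂
  obtain ⟨_, _, _, h₁, h₁'⟩ := h₁
  obtain ⟨_, _, _, h₂, h₂'⟩ := h₂
  rw [h₁'] at h₂'
  simp_all

/-- `c` leads to `c'` by the transitions `u`, and all stacks on the way have width at least `k`. -/
def ExecAbove (N : OnePS Q Γ) (k : ℕ) :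
    Config Q Γ → List (Transition Q Γ) → Config Q Γ → Prop
  | c, [], c' => k ≤ c.stack.width ∧ c = c'
  | c, δ :: u, c' => k ≤ c.stack.width ∧ ∃ c₁, N.Step δ c c₁ ∧ ExecAbove N k c₁ u c'

namespace ExecAbove

variable {k m : ℕ} {c c' c₁ c₂ : Config Q Γ} {u v : List (Transition Q Γ)}

theorem le_left (h : ExecAbove N k c u c') : k ≤ c.stack.width := by
  cases u <;> exact h.1

theorem le_right (h : ExecAbove N k c u c') : k ≤ c'.stack.width := by
  induction u generalizing c with
  | nil => exact h.2 ▸ h.1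
  | cons δ u ih => exact ih h.2.choose_spec.2

theorem mono (h : ExecAbove N k c u c') (hm : m ≤ k) : ExecAbove N m c u c' := by
  induction u generalizing c with
  | nil => exact ⟨hm.trans h.1, h.2⟩
  | cons δ u ih =>
    obtain ⟨h0, c₁, h1, h2⟩ := h
    exact ⟨hm.trans h0, c₁, h1, ih h2⟩

theorem append_iff : ExecAbove N k c (u ++ v) c' ↔
    ∃ c₁, ExecAbove N k c u c₁ ∧ ExecAbove N k c₁ v c' := by
  induction u generalizing c with
  | nil =>
    constructor
    · intro h
      exact ⟨c, ⟨h.le_left, rfl⟩, h⟩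
    · rintro ⟨c₁, ⟨_, rfl⟩, h⟩
      exact h
  | cons δ u ih =>
    simp only [List.cons_append, ExecAbove, ih]
    constructor
    · rintro ⟨h0, c₂, h1, c₁, h2, h3⟩
      exact ⟨c₁, ⟨h0, c₂, h1, h2⟩, h3⟩
    · rintro ⟨c₁, ⟨h0, c₂, h1, h2⟩, h3⟩
      exact ⟨h0, c₂, h1, c₁, h2, h3⟩

theorem unique (h₁ : ExecAbove N k c u c₁) (h₂ : ExecAbove N m c u c₂) : c₁ = c₂ := by
  induction u generalizing c with
  | nil => exact h₁.2.symm.trans h₂.2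
  | cons δ u ih =>
    obtain ⟨_, d₁, h1, h2⟩ := h₁
    obtain ⟨_, d₂, h3, h4⟩ := h₂
    obtain rfl := step_unique h1 h3
    exact ih h2 h4

theorem single (h : N.Step δ c c') : ExecAbove N 0 c [δ] c' := ⟨Nat.zero_le _, c', h, Nat.zero_le _, rfl⟩

/-- Either all stacks have width at least `k`, or there is a first narrower stack. -/
theorem split (h : ExecAbove N m c u c') (hk : k ≤ c.stack.width) :
    ExecAbove N k c u c' ∨ ∃ u₁ δ u₂ c₁ c₂, u = u₁ ++ δ :: u₂ ∧ ExecAbove N k c u₁ c₁ ∧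
      N.Step δ c₁ c₂ ∧ c₂.stack.width < k ∧ ExecAbove N m c₂ u₂ c' := by
  induction u generalizing c with
  | nil => exact Or.inl ⟨hk, h.2⟩
  | cons δ u ih =>
    obtain ⟨_, c₁, h1, h2⟩ := h
    by_cases h3 : k ≤ c₁.stack.width
    · rcases ih h2 h3 with h4 | ⟨u₁, ε, u₂, d₁, d₂, rfl, h5, h6, h7, h8⟩
      · exact Or.inl ⟨hk, c₁, h1, h4⟩
      · exact Or.inr ⟨δ :: u₁, ε, u₂, d₁, d₂, rfl, ⟨hk, c₁, h1, h5⟩, h6, h7, h8⟩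
    · exact Or.inr ⟨[], δ, u, c, c₁, rfl, ⟨hk, rfl⟩, h1, not_le.1 h3, h2⟩

theorem suffix (h : ExecAbove N k c u c') {s : List Γ} (hs : s.length ≤ k)
    (hc : s <:+ c.stack.1) : s <:+ c'.stack.1 := by
  induction u generalizing c with
  | nil => exact h.2 ▸ hc
  | cons δ u ih =>
    obtain ⟨_, c₁, h1, h2⟩ := h
    refine ih h2 ?_
    have h3 := h2.le_left
    obtain ⟨_, ⟨b, t, _, rfl, rfl⟩ | ⟨b, t, _, rfl, rfl⟩⟩ := step_iff.1 h1
    · exact hc.trans (List.suffix_cons _ _)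
    · rcases List.suffix_cons_iff.1 hc with h4 | h4
      · subst h4
        simp at hs h3
        omega
      · exact h4

/-- The letters below the level `k` are never touched, and neither stack has letters above it. -/
theorem stack_eq (h : ExecAbove N k c u c') (hc : c.stack.width = k)
    (hc' : c'.stack.width = k) : c'.stack = c.stack := by
  have h1 := h.suffix (s := c.stack.1) hc.le List.suffix_rfl
  exact Subtype.ext (h1.eq_of_length (hc.trans hc'.symm)).symm

end ExecAbove

/-! ### Nodes as words of transitions -/

namespace NPT

/-- The sequence of transitions of a node. -/
def word (x : NPT N) : List (Transition Q Γ) := x.1.steps.map Prod.fst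

/-- The width of the last stack of a node. -/
abbrev wd (x : NPT N) : ℕ := x.1.last.stack.width

theorem one_le_wd (x : NPT N) : 1 ≤ wd x := Stack.one_le_width _

@[simp] theorem length_word (x : NPT N) : (word x).length = x.1.length := by
  simp [word, Run.length]

end NPT

theorem isRun_append {c : Config Q Γ} {s t : List (Transition Q Γ × Config Q Γ)} :
    N.IsRun c (s ++ t) ↔ N.IsRun c s ∧ N.IsRun ((s.map Prod.snd).getLastD c) t := by
  induction s generalizing c with
  | nil => simp [OnePS.IsRun]
  | cons p s ih =>
    obtain ⟨δ, d⟩ := p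
    simp only [List.cons_append, OnePS.IsRun, ih, List.map_cons, List.getLastD_cons, and_assoc]

theorem isRun_ext {c : Config Q Γ} {s t : List (Transition Q Γ × Config Q Γ)}
    (hs : N.IsRun c s) (ht : N.IsRun c t) (h : s.map Prod.fst = t.map Prod.fst) : s = t := by
  induction s generalizing c t with
  | nil => simpa using h.symm
  | cons p s ih =>
    cases t with
    | nil => simp at h
    | cons p' t =>
      obtain ⟨δ, d⟩ := p
      obtain ⟨δ', d'⟩ := p'
      simp only [List.map_cons, List.cons.injEq] at h
      obtain ⟨rfl, h⟩ := h
      obtain rfl := step_unique hs.1 ht.1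
      rw [ih hs.2 ht.2 h]

theorem isRun_exec {c : Config Q Γ} {s : List (Transition Q Γ × Config Q Γ)}
    (hs : N.IsRun c s) : ExecAbove N 0 c (s.map Prod.fst) ((s.map Prod.snd).getLastD c) := by
  induction s generalizing c with
  | nil => exact ⟨Nat.zero_le _, rfl⟩
  | cons p s ih =>
    obtain ⟨δ, d⟩ := p
    exact ⟨Nat.zero_le _, d, hs.1, by simpa only [List.map_cons, List.getLastD_cons] using ih hs.2⟩

theorem exists_isRun {c c' : Config Q Γ} {u : List (Transition Q Γ)}
    (h : ExecAbove N 0 c u c') : ∃ s, N.IsRun c s ∧ s.map Prod.fst = u := by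
  induction u generalizing c with
  | nil => exact ⟨[], trivial, rfl⟩
  | cons δ u ih =>
    obtain ⟨_, c₁, h1, h2⟩ := h
    obtain ⟨s, hs, rfl⟩ := ih h2
    exact ⟨(δ, c₁) :: s, ⟨h1, hs⟩, rfl⟩

theorem getD_cons_eq_getLastD {α : Type*} (l : List α) (c : α) :
    (c :: l).getD l.length c = l.getLastD c := by
  induction l generalizing c with
  | nil => rfl
  | cons a l ih =>
    rw [List.getLastD_cons, ← ih]
    simp

theorem Run.last_eq (r : Run N) : r.last = (r.steps.map Prod.snd).getLastD r.start := by
  rw [← getD_cons_eq_getLastD]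
  simp [Run.last, Run.conf, Run.length]

theorem Run.exec (r : Run N) : ExecAbove N 0 r.start (r.steps.map Prod.fst) r.last := by
  rw [r.last_eq]
  exact isRun_exec r.isRun

theorem Run.exec_conf (r : Run N) {i : ℕ} (hi : i ≤ r.length) :
    ExecAbove N 0 r.start ((r.steps.map Prod.fst).take i) (r.conf i) := by
  have h := isRun_exec (isRun_append.1 (by
    rw [List.take_append_drop i r.steps]; exact r.isRun)).1
  convert h using 1
  · rw [List.map_take]
  · rw [← getD_cons_eq_getLastD]
    unfold Run.length at hi
    cases i with
    | zero => simp [Run.conf]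
    | succ i => simp [Run.conf, hi, List.getD_eq_getElem?_getD]

namespace NPT

theorem exec_word (x : NPT N) : ExecAbove N 0 N.initConfig (word x) x.1.last := by
  have := x.1.exec
  rwa [x.2] at this

theorem word_injective : Function.Injective (word (N := N)) := by
  rintro ⟨⟨c, s, hs⟩, hc⟩ ⟨⟨c', s', hs'⟩, hc'⟩ h
  dsimp only at hc hc'
  subst hc hc'
  have := isRun_ext hs hs' h
  subst this
  rfl

theorem exists_word {u : List (Transition Q Γ)} {c : Config Q Γ}
    (h : ExecAbove N 0 N.initConfig u c) : ∃ x : NPT N, word x = u ∧ x.1.last = c := by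
  obtain ⟨s, hs, rfl⟩ := exists_isRun h
  refine ⟨⟨⟨_, s, hs⟩, rfl⟩, rfl, ?_⟩
  exact (exec_word (⟨⟨_, s, hs⟩, rfl⟩ : NPT N)).unique h

theorem exists_append {x : NPT N} {u : List (Transition Q Γ)} {c : Config Q Γ}
    (h : ExecAbove N 0 x.1.last u c) : ∃ y : NPT N, word y = word x ++ u ∧ y.1.last = c :=
  exists_word (ExecAbove.append_iff.2 ⟨_, exec_word x, h⟩)

theorem exec_of_word {x y : NPT N} {u : List (Transition Q Γ)} (h : word y = word x ++ u) :
    ExecAbove N 0 x.1.last u y.1.last := by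
  have h1 := exec_word y
  rw [h, ExecAbove.append_iff] at h1
  obtain ⟨c, h2, h3⟩ := h1
  rwa [(exec_word x).unique h2]

theorem exists_of_prefix {y : NPT N} {u v : List (Transition Q Γ)} (h : word y = u ++ v) :
    ∃ x : NPT N, word x = u := by
  have h1 := exec_word y
  rw [h, ExecAbove.append_iff] at h1
  obtain ⟨c, h2, h3⟩ := h1
  obtain ⟨x, hx, _⟩ := exists_word h2
  exact ⟨x, hx⟩

/-- Nodes are ordered by the initial segment relation. -/
instance : PartialOrder (NPT N) where
  le x y := word x <+: word y
  le_refl x := List.prefix_rfl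
  le_trans _ _ _ := List.IsPrefix.trans
  le_antisymm x y h h' := word_injective (h.eq_of_length (le_antisymm h.length_le h'.length_le))

theorem steps_of_word {x y : NPT N} {u : List (Transition Q Γ)} (h : word y = word x ++ u) :
    ∃ r : Run N, Run.IsComp x.1 r y.1 ∧ r.steps.map Prod.fst = u := by
  obtain ⟨⟨c', s, hs⟩, hc'⟩ := x
  obtain ⟨⟨c, t, ht⟩, hc⟩ := y
  dsimp only at hc hc'
  subst hc hc'
  obtain ⟨t₁, t₂, rfl, h1, rfl⟩ := List.map_eq_append_iff.1 h
  have h2 := isRun_append.1 ht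
  obtain rfl := isRun_ext h2.1 hs h1
  exact ⟨⟨_, t₂, h2.2⟩, ⟨Run.last_eq _, rfl, rfl⟩, rfl⟩

theorem word_of_isComp {x y : NPT N} {r : Run N} (h : Run.IsComp x.1 r y.1) :
    word y = word x ++ r.steps.map Prod.fst := by
  unfold word
  rw [h.2.2, List.map_append]

theorem prefix_iff {x y : NPT N} : x.1.Prefix y.1 ↔ x ≤ y := by
  constructor
  · intro h
    exact h.2.map _
  · rintro ⟨u, h⟩
    obtain ⟨r, h1, _⟩ := steps_of_word h.symm
    exact ⟨h1.2.1.symm, r.steps, h1.2.2.symm⟩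

theorem strictPrefix_iff {x y : NPT N} : x.1.StrictPrefix y.1 ↔ x < y := by
  rw [lt_iff_le_and_ne, Run.StrictPrefix, prefix_iff]
  exact and_congr_right fun _ => not_congr Subtype.ext_iff.symm

theorem le_total_of_le {x y z : NPT N} (hx : x ≤ z) (hy : y ≤ z) : x ≤ y ∨ y ≤ x :=
  List.prefix_or_prefix_of_prefix hx hy

theorem lt_or_le_of_le {x y z : NPT N} (hx : x ≤ z) (hy : y ≤ z) : x < y ∨ y ≤ x := by
  rcases le_total_of_le hx hy with h | h
  · rcases h.eq_or_lt with h | h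
    · exact Or.inr h.ge
    · exact Or.inl h
  · exact Or.inr h

theorem length_lt {x y : NPT N} (h : x < y) : x.1.length < y.1.length := by
  rw [← length_word, ← length_word]
  by_contra h'
  exact h.ne (word_injective (h.le.eq_of_length_le (not_lt.1 h')))

theorem exists_word_append {x y : NPT N} (h : x ≤ y) : ∃ u, word y = word x ++ u := by
  obtain ⟨u, h⟩ := h
  exact ⟨u, h.symm⟩

theorem le_of_word {x y : NPT N} {u : List (Transition Q Γ)} (h : word y = word x ++ u) :
    x ≤ y := ⟨u, h.symm⟩

theorem exists_word_cons {x y : NPT N} (h : x < y) : ∃ δ u, word y = word x ++ δ :: u := by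
  obtain ⟨u, hu⟩ := exists_word_append h.le
  cases u with
  | nil => exact absurd (word_injective (by simpa using hu.symm)) h.ne
  | cons δ u => exact ⟨δ, u, hu⟩

theorem lt_of_word {x y : NPT N} {δ : Transition Q Γ} {u : List (Transition Q Γ)}
    (h : word y = word x ++ δ :: u) : x < y := by
  refine (le_of_word h).lt_of_ne ?_
  rintro rfl
  simp at h

theorem exec_iff_wd {x y : NPT N} {u : List (Transition Q Γ)} (h : word y = word x ++ u) {k : ℕ} :
    ExecAbove N k x.1.last u y.1.last ↔ ∀ z, x ≤ z → z ≤ y → k ≤ wd z := by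
  constructor
  · intro h1 z hxz hzy
    obtain ⟨v, hv⟩ := exists_word_append hxz
    obtain ⟨w, hw⟩ := exists_word_append hzy
    rw [h, hv, List.append_assoc, List.append_cancel_left_eq] at hw
    subst hw
    obtain ⟨c, h2, h3⟩ := ExecAbove.append_iff.1 h1
    have := h2.le_right
    rwa [h2.unique (exec_of_word hv)] at this
  · intro h1
    rcases (exec_of_word h).split (h1 x le_rfl (le_of_word h)) with h2 |
      ⟨u₁, δ, u₂, c₁, c₂, rfl, h2, h3, h4, h5⟩
    · exact h2
    · obtain ⟨z, hz, rfl⟩ := exists_append (x := x) (u := u₁ ++ [δ]) (c := c₂)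
        (ExecAbove.append_iff.2 ⟨c₁, h2.mono (Nat.zero_le _), .single h3⟩)
      refine absurd (h1 z (le_of_word hz) (le_of_word (u := u₂) ?_)) (not_le.2 h4)
      rw [h, hz]
      simp

/-! ### The three kinds of edges in terms of words and widths -/

theorem edge_iff {δ : Transition Q Γ} {x y : NPT N} : Edge δ x y ↔ word y = word x ++ [δ] := by
  constructor
  · rintro ⟨r, c, h1, h2⟩
    rw [word_of_isComp h2, h1]
    rfl
  · intro h
    obtain ⟨r, h1, h2⟩ := steps_of_word h
    obtain ⟨⟨δ', c⟩, s, hs, rfl, h3⟩ := List.map_eq_cons_iff.1 h2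
    rw [List.map_eq_nil_iff] at h3
    subst h3
    exact ⟨r, c, hs, h1⟩

theorem Edge.step {δ : Transition Q Γ} {x y : NPT N} (h : Edge δ x y) :
    N.Step δ x.1.last y.1.last := by
  obtain ⟨_, c, h1, h2⟩ := exec_of_word (edge_iff.1 h)
  exact h2.2 ▸ h1

theorem Edge.mem {δ : Transition Q Γ} {x y : NPT N} (h : Edge δ x y) : δ ∈ N.trans := h.step.1

theorem Edge.lt {δ : Transition Q Γ} {x y : NPT N} (h : Edge δ x y) : x < y :=
  lt_of_word (edge_iff.1 h)

theorem Edge.le_of_lt {δ : Transition Q Γ} {x y z : NPT N} (h : Edge δ x y) (hz : z < y) :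
    z ≤ x := by
  rcases lt_or_le_of_le h.lt.le hz.le with h1 | h1
  · have h2 := length_lt h1
    have h3 := length_lt hz
    have h4 := congrArg List.length (edge_iff.1 h)
    simp at h4
    omega
  · exact h1

theorem Edge.wd_pop {δ : Transition Q Γ} {x y : NPT N} (h : Edge δ x y) (hp : δ.op = .pop) :
    wd x = wd y + 1 := by
  obtain ⟨_, ⟨b, t, h1, h2, h3⟩ | ⟨b, t, h1, h2, h3⟩⟩ := step_iff.1 h.step
  · simp [hp] at h1
  · simp [wd, h2, h3]

theorem Edge.wd_push {δ : Transition Q Γ} {x y : NPT N} (h : Edge δ x y) {b : Γ}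
    (hp : δ.op = .push b) : wd y = wd x + 1 := by
  obtain ⟨_, ⟨b, t, h1, h2, h3⟩ | ⟨b, t, h1, h2, h3⟩⟩ := step_iff.1 h.step
  · simp [wd, h2, h3]
  · simp [hp] at h1

theorem plusEdge_iff {x y : NPT N} : PlusEdge x y ↔
    x < y ∧ wd x + 1 = wd y ∧ ∀ z, x < z → z < y → wd x < wd z := by
  simp only [PlusEdge, strictPrefix_iff]
  rfl

theorem plusEdge_iff_exec {x y : NPT N} : PlusEdge x y ↔
    wd x + 1 = wd y ∧ ∃ δ b u c, word y = word x ++ δ :: u ∧ N.Step δ x.1.last c ∧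
      δ.op = .push b ∧ ExecAbove N (wd x + 1) c u y.1.last := by
  rw [plusEdge_iff]
  constructor
  · rintro ⟨h1, h2, h3⟩
    obtain ⟨δ, u, hu⟩ := exists_word_cons h1
    obtain ⟨_, c, h4, h5⟩ := exec_of_word hu
    obtain ⟨t, ht, rfl⟩ := exists_append (.single h4)
    have h7 : word y = word t ++ u := by simp [hu, ht]
    have h6 : ∀ z, t ≤ z → z ≤ y → wd x + 1 ≤ wd z := fun z hz hzy => by
      rcases hzy.eq_or_lt with rfl | hzy
      · exact h2.le
      · exact h3 z ((lt_of_word ht).trans_le hz) hzy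
    refine ⟨h2, δ, ?_⟩
    have h8 := h6 t le_rfl (le_of_word h7)
    obtain ⟨_, ⟨b, s, h9, h10, h11⟩ | ⟨b, s, h9, h10, h11⟩⟩ := step_iff.1 h4
    · exact ⟨b, u, _, hu, h4, h9, (exec_iff_wd h7).2 h6⟩
    · simp [wd, h10, h11] at h8
  · rintro ⟨h2, δ, b, u, c, hu, h4, h9, h5⟩
    refine ⟨lt_of_word hu, h2, fun z hz hzy => ?_⟩
    obtain ⟨t, ht, rfl⟩ := exists_append (.single h4)
    have h7 : word y = word t ++ u := by simp [hu, ht]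
    refine (exec_iff_wd h7).1 h5 z ?_ hzy.le
    rcases lt_or_le_of_le hzy.le (le_of_word h7) with h8 | h8
    · exact absurd ((edge_iff.2 ht).le_of_lt h8) hz.not_ge
    · exact h8

/-- A jump is a `+1`-edge followed by a pop, so that most facts about jumps reduce to `+1`-edges and
single transitions. -/
theorem jump_iff {x y : NPT N} :
    Jump x y ↔ ∃ z δ, Edge δ z y ∧ δ.op = .pop ∧ PlusEdge x z := by
  constructor
  · rintro ⟨r, h1, h2, h3, ⟨p, hp, σ, hσ⟩, ⟨p', hp', hpop⟩, h6⟩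
    have hw := word_of_isComp h1
    obtain ⟨δ, v, δ', hv, hδ, hδ'⟩ : ∃ δ v δ', r.steps.map Prod.fst = δ :: (v ++ [δ']) ∧
        δ = p.1 ∧ δ' = p'.1 := by
      unfold Run.length at h2
      rcases hs : r.steps with _ | ⟨e, s⟩
      · simp [hs] at h2
      · rcases List.eq_nil_or_concat s with rfl | ⟨s', e', rfl⟩
        · simp [hs] at h2
        · refine ⟨e.1, s'.map Prod.fst, e'.1, by simp, ?_, ?_⟩
          · simp [hs] at hp
            rw [hp]
          · rw [hs, List.concat_eq_append, ← List.cons_append, List.getLast?_concat] at hp'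
            simp at hp'
            rw [hp']
    have hlen : r.length = v.length + 2 := by
      have := congrArg List.length hv
      simpa [Run.length] using this
    rw [hv] at hw
    obtain ⟨z, hz⟩ := exists_of_prefix (y := y) (u := word x ++ δ :: v) (v := [δ']) (by simp [hw])
    have hE : Edge δ' z y := edge_iff.2 (by simp [hw, hz])
    have hpop' : δ'.op = .pop := hδ' ▸ hpop
    refine ⟨z, δ', hE, hpop', plusEdge_iff_exec.2 ⟨?_, δ, σ, v, ?_⟩⟩
    · have h7 : y.1.last.stack = x.1.last.stack := by
        rw [h1.1, ← h3]
        have h8 := exec_of_word (word_of_isComp h1)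
        rw [h1.1] at h8
        rw [h8.unique r.exec]
      rw [hE.wd_pop hpop']
      simp [wd, h7]
    · obtain ⟨_, c, h7, h8⟩ := exec_of_word hz
      refine ⟨c, hz, h7, hδ ▸ hσ, ?_⟩
      have hpush : δ.op = .push σ := hδ ▸ hσ
      obtain ⟨_, ⟨b, s, h9, h10, h11⟩ | ⟨b, s, h9, h10, h11⟩⟩ := step_iff.1 h7
      · have hwx : wd x + 1 = c.stack.width := by simp [wd, h10, h11]
        -- The first transition to a stack narrower than `wd x + 1` would be a pop that uncovers
        -- exactly the stack of `x`, at an inner position of the jump.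
        rcases h8.split hwx.le with h12 | ⟨u₁, ε, u₂, c₁, c₂, rfl, h12, h13, h14, h15⟩
        · exact h12
        · exfalso
          have h16 := h12.le_right
          have h17 : c₂.stack = x.1.last.stack := by
            have h18 : c₁.stack.width = wd x + 1 := by
              obtain ⟨_, ⟨b, s, _, h20, h21⟩ | ⟨b, s, _, h20, h21⟩⟩ := step_iff.1 h13
              · simp [h20, h21] at h14 h16; omega
              · simp [h20, h21] at h14 h16 ⊢; omega
            have h19 := h12.stack_eq hwx.symm h18
            obtain ⟨_, ⟨b', s', _, h20, h21⟩ | ⟨b', s', _, h20, h21⟩⟩ := step_iff.1 h13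
            · simp [h20, h21] at h14 h18; omega
            · rw [h20, h11] at h19
              have h22 := congrArg Subtype.val h19
              simp at h22
              rw [h21, h10]
              exact Subtype.ext (by simp [h22.2])
          -- The two extra transitions are the initial push `δ` and the pop `ε`.
          refine h6 (u₁.length + 2) (by omega) (by simp at hlen; omega) ?_
          rw [← h1.1, ← h17]
          have h18 := r.exec_conf (i := u₁.length + 2) (by simp at hlen; omega)
          have h19 : ExecAbove N 0 r.start (δ :: (u₁ ++ [ε])) c₂ := by
            rw [← h1.1]
            exact ⟨Nat.zero_le _, c, h7, ExecAbove.append_iff.2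
              ⟨c₁, h12.mono (Nat.zero_le _), .single h13⟩⟩
          have h20 : (r.steps.map Prod.fst).take (u₁.length + 2) = δ :: (u₁ ++ [ε]) := by
            rw [hv]
            simp [List.take_append]
          rw [h20] at h18
          rw [h18.unique h19]
      · simp [hpush] at h9
  · rintro ⟨z, δ', hE, hpop, hP⟩
    obtain ⟨h1, δ, b, v, c, h2, h3, h4, h5⟩ := plusEdge_iff_exec.1 hP
    have hw : word y = word x ++ δ :: (v ++ [δ']) := by rw [edge_iff.1 hE, h2]; simp
    obtain ⟨r, h6, h7⟩ := steps_of_word hw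
    obtain ⟨⟨_, c'⟩, s, hs, rfl, h7'⟩ := List.map_eq_cons_iff.1 h7
    obtain ⟨s₁, s₂, rfl, rfl, h8⟩ := List.map_eq_append_iff.1 h7'
    obtain ⟨⟨_, c''⟩, s', rfl, rfl, h9⟩ := List.map_eq_cons_iff.1 h8
    rw [List.map_eq_nil_iff] at h9
    subst h9
    have hlast : r.last = y.1.last := by
      have h8 := exec_of_word (word_of_isComp h6)
      rw [h6.1] at h8
      exact r.exec.unique h8
    refine ⟨r, h6, by simp [Run.length, hs], ?_, ⟨_, by rw [hs]; rfl, b, h4⟩, ⟨_, by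
      rw [hs, ← List.cons_append, List.getLast?_concat]; rfl, hpop⟩, fun i hi hi' h10 => ?_⟩
    · rw [hlast, ← h6.1]
      obtain ⟨_, ⟨b, s, h9, h10, h11⟩ | ⟨b, s, h9, h10, h11⟩⟩ := step_iff.1 h3
      · have h12 := h5.stack_eq (by simp [wd, h10, h11]) h1.symm
        obtain ⟨_, ⟨b', s', h13, _⟩ | ⟨b', s', _, h20, h21⟩⟩ := step_iff.1 hE.step
        · exact absurd (h13.symm.trans hpop) (by simp)
        · rw [h20, h11] at h12
          have h22 := congrArg Subtype.val h12
          simp at h22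
          rw [h21, h10]
          exact Subtype.ext (by simp [h22.2])
      · exact absurd (h4.symm.trans h9) (by simp)
    · have h11 := r.exec_conf hi'.le
      obtain ⟨j, rfl⟩ : ∃ j, i = j + 1 := ⟨i - 1, by omega⟩
      rw [h7, List.take_succ_cons, ← h6.1] at h11
      obtain ⟨_, d, h12, h13⟩ := h11
      obtain rfl := step_unique h3 h12
      have hj : j ≤ (s₁.map Prod.fst).length := by
        simp [Run.length, hs] at hi' ⊢
        omega
      rw [List.take_append_of_le_length hj] at h13
      rw [← List.take_append_drop j (s₁.map Prod.fst)] at h5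
      obtain ⟨e, h14, _⟩ := ExecAbove.append_iff.1 h5
      have h15 := h14.le_right
      rw [h14.unique h13, h10, ← h6.1] at h15
      simp [wd] at h15

theorem two_le_wd_of_lt {x z : NPT N} (h : wd x < wd z) : 2 ≤ wd z := by
  have := one_le_wd x
  omega

theorem PlusEdge.lt {x y : NPT N} (h : PlusEdge x y) : x < y := (plusEdge_iff.1 h).1

theorem PlusEdge.wd_eq {x y : NPT N} (h : PlusEdge x y) : wd y = wd x + 1 :=
  (plusEdge_iff.1 h).2.1.symm

theorem PlusEdge.wd_lt {x y z : NPT N} (h : PlusEdge x y) (hz : x < z) (hzy : z ≤ y) :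
    wd x < wd z := by
  rcases hzy.eq_or_lt with rfl | hzy
  · rw [h.wd_eq]; omega
  · exact (plusEdge_iff.1 h).2.2 z hz hzy

theorem Jump.lt {x y : NPT N} (h : Jump x y) : x < y := by
  obtain ⟨z, δ, h1, h2, h3⟩ := jump_iff.1 h
  exact h3.lt.trans h1.lt

theorem Jump.wd_eq {x y : NPT N} (h : Jump x y) : wd y = wd x := by
  obtain ⟨z, δ, h1, h2, h3⟩ := jump_iff.1 h
  have := h1.wd_pop h2
  have := h3.wd_eq
  omega

theorem Jump.wd_lt {x y z : NPT N} (h : Jump x y) (hz : x < z) (hzy : z < y) :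
    wd x < wd z := by
  obtain ⟨w, δ, h1, h2, h3⟩ := jump_iff.1 h
  exact h3.wd_lt hz (h1.le_of_lt hzy)

theorem Jump.stack_eq {x y : NPT N} (h : Jump x y) : y.1.last.stack = x.1.last.stack := by
  obtain ⟨r, h1, _, h3, _⟩ := h
  have h4 := exec_of_word (word_of_isComp h1)
  rw [h1.1] at h4
  rw [h1.1, ← h3, h4.unique r.exec]

theorem PlusEdge.of_lt {x y : NPT N} (h : x < y) (hw : wd x + 1 = wd y)
    (h' : ∀ z, x < z → z < y → wd x < wd z) : PlusEdge x y := plusEdge_iff.2 ⟨h, hw, h'⟩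

theorem Edge.plusEdge {δ : Transition Q Γ} {x y : NPT N} (h : Edge δ x y) {b : Γ}
    (hp : δ.op = .push b) : PlusEdge x y :=
  .of_lt h.lt (h.wd_push hp).symm fun _ h1 h2 => absurd (h.le_of_lt h2) h1.not_ge

theorem Edge.jump {δ : Transition Q Γ} {x y z : NPT N} (h : Edge δ z y) (hp : δ.op = .pop)
    (h' : PlusEdge x z) : Jump x y := jump_iff.2 ⟨z, δ, h, hp, h'⟩

/-! ### Uniqueness and existence of predecessors -/

/-- If one source lay strictly between the other source and `y`, it would have to be wider than that
source, but both have width `wd y - 1`. -/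
theorem PlusEdge.unique {x x' y : NPT N} (h : PlusEdge x y) (h' : PlusEdge x' y) : x = x' := by
  have h1 := h.wd_eq
  have h2 := h'.wd_eq
  rcases lt_or_le_of_le h.lt.le h'.lt.le with h3 | h3
  · have := h.wd_lt h3 h'.lt.le
    omega
  · rcases h3.eq_or_lt with h3 | h3
    · exact h3.symm
    · have := h'.wd_lt h3 h.lt.le
      omega

theorem Jump.unique {x x' y : NPT N} (h : Jump x y) (h' : Jump x' y) : x = x' := by
  have h1 := h.wd_eq
  have h2 := h'.wd_eq
  rcases lt_or_le_of_le h.lt.le h'.lt.le with h3 | h3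
  · have := h.wd_lt h3 h'.lt
    omega
  · rcases h3.eq_or_lt with h3 | h3
    · exact h3.symm
    · have := h'.wd_lt h3 h.lt
      omega

theorem Edge.unique {δ δ' : Transition Q Γ} {x x' y : NPT N} (h : Edge δ x y)
    (h' : Edge δ' x' y) : x = x' ∧ δ = δ' := by
  have h1 := edge_iff.1 h
  rw [edge_iff.1 h'] at h1
  obtain ⟨h2, h3⟩ := List.append_inj' h1 rfl
  exact ⟨(word_injective h2).symm, by simpa using h3.symm⟩

theorem Edge.unique_right {δ : Transition Q Γ} {x y y' : NPT N} (h : Edge δ x y)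
    (h' : Edge δ x y') : y = y' :=
  word_injective ((edge_iff.1 h).trans (edge_iff.1 h').symm)

theorem Edge.exists_jump {δ : Transition Q Γ} {y z : NPT N} (h : Edge δ z y)
    {x : NPT N} (h' : Jump x y) : δ.op = .pop ∧ PlusEdge x z := by
  obtain ⟨w, ε, h1, h2, h3⟩ := jump_iff.1 h'
  obtain ⟨rfl, rfl⟩ := h.unique h1
  exact ⟨h2, h3⟩

/-- A jump only passes over wider stacks, so it neither creates nor destroys a last narrower
position. -/
theorem Jump.plusEdge_iff {x y g : NPT N} (h : Jump g y) : PlusEdge x y ↔ PlusEdge x g := by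
  have h1 := h.wd_eq
  constructor
  · intro h2
    have h3 := h2.wd_eq
    rcases lt_or_le_of_le h2.lt.le h.lt.le with h4 | h4
    · exact .of_lt h4 (by omega) fun z hz hzg => h2.wd_lt hz (hzg.trans h.lt).le
    · rcases h4.eq_or_lt with rfl | h4
      · omega
      · have := h.wd_lt h4 h2.lt
        omega
  · intro h2
    have h3 := h2.wd_eq
    refine .of_lt (h2.lt.trans h.lt) (by omega) fun z hz hzy => ?_
    rcases lt_or_le_of_le h.lt.le hzy.le with h4 | h4
    · have := h.wd_lt h4 hzy
      omega
    · exact h2.wd_lt hz h4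

/-- The run of length zero. -/
def nil (N : OnePS Q Γ) : NPT N := ⟨⟨N.initConfig, [], trivial⟩, rfl⟩

@[simp] theorem word_nil : word (nil N) = [] := rfl
@[simp] theorem last_nil : (nil N).1.last = N.initConfig := rfl
@[simp] theorem length_nil : (nil N).1.length = 0 := rfl

theorem nil_le (x : NPT N) : nil N ≤ x := List.nil_prefix

theorem exists_edge {y : NPT N} (h : y ≠ nil N) : ∃ δ z, Edge δ z y := by
  rcases List.eq_nil_or_concat (word y) with h1 | ⟨u, δ, h1⟩
  · exact absurd (word_injective h1) h
  · rw [List.concat_eq_append] at h1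
    obtain ⟨z, hz⟩ := exists_of_prefix h1
    exact ⟨δ, z, edge_iff.2 (by rw [h1, hz])⟩

theorem not_edge_nil {δ : Transition Q Γ} {x : NPT N} : ¬Edge δ x (nil N) := by
  simp [edge_iff]

/-- If the last transition is a push, its source works. If it is a pop, the source of the jump to
`y` is shorter and has the same `+1`-predecessor. -/
theorem exists_plusEdge {y : NPT N} (h : 2 ≤ wd y) : ∃ x, PlusEdge x y := by
  induction hn : y.1.length using Nat.strong_induction_on generalizing y with
  | _ n ih =>
  subst hn
  obtain ⟨δ, z, h1⟩ := exists_edge (y := y) (by rintro rfl; simp [wd, OnePS.initConfig, Stack.width] at h)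
  cases hop : δ.op with
  | push b => exact ⟨z, h1.plusEdge hop⟩
  | pop =>
    have h2 := h1.wd_pop hop
    obtain ⟨g, hg⟩ := ih _ (length_lt h1.lt) (y := z) (by omega) rfl
    have h3 := h1.jump hop hg
    obtain ⟨x, hx⟩ := ih _ (length_lt h3.lt) (y := g) (by rw [← h3.wd_eq]; exact h) rfl
    exact ⟨x, h3.plusEdge_iff.2 hx⟩

theorem exists_jump {δ : Transition Q Γ} {y z : NPT N} (h : Edge δ z y) (hp : δ.op = .pop) :
    ∃ x, Jump x y := by
  obtain ⟨x, hx⟩ := exists_plusEdge (y := z) (by rw [h.wd_pop hp]; have := one_le_wd y; omega)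
  exact ⟨x, h.jump hp hx⟩

theorem exists_stack_eq (x : NPT N) : ∃ t, x.1.last.stack.1 = t ++ [N.bot] ∧ N.bot ∉ t := by
  have h := exec_word x
  suffices ∀ (u : List (Transition Q Γ)) (c : Config Q Γ), ExecAbove N 0 c u x.1.last →
      (∃ t, c.stack.1 = t ++ [N.bot] ∧ N.bot ∉ t) →
      ∃ t, x.1.last.stack.1 = t ++ [N.bot] ∧ N.bot ∉ t from
    this _ _ h ⟨[], rfl, List.not_mem_nil⟩
  intro u
  induction u with
  | nil =>
    rintro c ⟨_, rfl⟩ h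
    exact h
  | cons δ u ih =>
    rintro c ⟨_, c₁, h1, h2⟩ ⟨t, ht, hb⟩
    refine ih c₁ h2 ?_
    obtain ⟨hδ, ⟨b, s, h3, rfl, rfl⟩ | ⟨b, s, h3, rfl, rfl⟩⟩ := step_iff.1 h1
    · refine ⟨b :: t, by simpa using ht, ?_⟩
      have := N.push_ne_bot δ hδ b h3
      simp [hb, this.symm]
    · cases t with
      | nil => simp at ht
      | cons a t =>
        simp at ht hb
        exact ⟨t, ht.2, hb.2⟩

/-- The bottom symbol occurs only at the bottom. Thus the label of a node decides whether it has a
`+1`-predecessor, and label-preserving maps respect this. -/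
theorem two_le_wd_iff (x : NPT N) : 2 ≤ wd x ↔ x.1.last.stack.top ≠ N.bot := by
  obtain ⟨t, ht, hb⟩ := exists_stack_eq x
  obtain ⟨q, a, s, h⟩ := exists_eq_cfg x.1.last
  rw [h] at ht
  simp only [wd, h, cfg_width, cfg_top]
  cases t with
  | nil => simp at ht; simp [ht]
  | cons b t =>
    simp at ht hb
    simp [ht, Ne.symm hb.1]

/-! ### The geometry of relevant ancestors -/

/-- The union of the three kinds of edges. -/
def Par (x y : NPT N) : Prop := (∃ δ ∈ N.trans, Edge δ x y) ∨ Jump x y ∨ PlusEdge x y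

theorem Edge.par {δ : Transition Q Γ} {x y : NPT N} (h : Edge δ x y) : Par x y :=
  Or.inl ⟨δ, h.mem, h⟩

theorem Jump.par {x y : NPT N} (h : Jump x y) : Par x y := Or.inr (Or.inl h)

theorem PlusEdge.par {x y : NPT N} (h : PlusEdge x y) : Par x y := Or.inr (Or.inr h)

theorem Par.lt {x y : NPT N} (h : Par x y) : x < y := by
  rcases h with ⟨δ, _, h⟩ | h | h <;> exact h.lt

theorem Par.wd_le {x y : NPT N} (h : Par x y) : wd x ≤ wd y + 1 := by
  rcases h with ⟨δ, _, h⟩ | h | h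
  · cases hop : δ.op with
    | push b => rw [h.wd_push hop]; omega
    | pop => rw [h.wd_pop hop]
  · rw [h.wd_eq]; omega
  · rw [h.wd_eq]; omega

/-- A node which is passed over by an edge ends in a stack that is wider than the one at the source
and at least as wide as the one at the target of the edge. -/
theorem Par.wd_between {x y z : NPT N} (h : Par x y) (hz : x < z) (hzy : z < y) :
    wd x < wd z ∧ wd y ≤ wd z ∧ wd y ≤ wd x + 1 := by
  rcases h with ⟨δ, _, h⟩ | h | h
  · exact absurd (h.le_of_lt hzy) hz.not_ge
  · have := h.wd_lt hz hzy
    have := h.wd_eq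
    omega
  · have := h.wd_lt hz hzy.le
    have := h.wd_eq
    omega

/-- The edge from `a` passes over `b`, so `wd c ≤ wd b`; the edge from `b` passes over `c`, so `wd b
< wd c`. -/
theorem Par.not_cross {a b c d : NPT N} (h : Par a c) (h' : Par b d) (hab : a < b) (hbc : b < c)
    (hcd : c < d) : False := by
  have := h.wd_between hab hbc
  have := h'.wd_between hbc hcd
  omega

theorem self_mem_relAnc (l : ℕ) (ρ : NPT N) : ρ ∈ relAnc l ρ := by
  induction l with
  | zero => rfl
  | succ l ih => exact Or.inl ih

theorem relAnc_mono {k l : ℕ} (h : k ≤ l) (ρ : NPT N) : relAnc k ρ ⊆ relAnc l ρ := by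
  induction h with
  | refl => exact subset_rfl
  | step _ ih => exact fun x hx => Or.inl (ih hx)

theorem Par.mem_relAnc {l : ℕ} {ρ x y : NPT N} (h : Par x y) (hy : y ∈ relAnc l ρ) :
    x ∈ relAnc (l + 1) ρ := Or.inr ⟨y, hy, h⟩

theorem le_of_mem_relAnc {l : ℕ} {ρ x : NPT N} (h : x ∈ relAnc l ρ) : x ≤ ρ := by
  induction l generalizing x with
  | zero => exact le_of_eq h
  | succ l ih =>
    rcases h with h | ⟨y, hy, h⟩
    · exact ih h
    · exact (Par.lt h).le.trans (ih hy)

theorem relAnc_trans {k l : ℕ} {ρ x y : NPT N} (hx : x ∈ relAnc k y) (hy : y ∈ relAnc l ρ) :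
    x ∈ relAnc (l + k) ρ := by
  induction k generalizing x with
  | zero => obtain rfl : x = y := hx; exact hy
  | succ k ih =>
    rcases hx with hx | ⟨z, hz, hx⟩
    · exact Or.inl (ih hx)
    · exact Or.inr ⟨z, ih hz, hx⟩

theorem wd_le_of_mem_relAnc {k : ℕ} {ρ x : NPT N} (hx : x ∈ relAnc k ρ) : wd x ≤ wd ρ + k := by
  induction k generalizing x with
  | zero => obtain rfl : x = ρ := hx; rfl
  | succ k ih =>
    rcases hx with hx | ⟨z, hz, hx⟩
    · have := ih hx; omega
    · have := ih hz
      have := Par.wd_le hx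
      omega

/-- A path of edges to a node that is passed over by an edge goes through the target of it. -/
theorem relAnc_through {k : ℕ} {ρ a b x : NPT N} (hab : Par b a) (haρ : a ≤ ρ) (hbx : b < x)
    (hxa : x < a) (hx : x ∈ relAnc k ρ) :
    ∃ t s, t + s = k ∧ 0 < s ∧ a ∈ relAnc t ρ ∧ x ∈ relAnc s a := by
  induction k generalizing x with
  | zero =>
    obtain rfl : x = ρ := hx
    exact absurd haρ hxa.not_ge
  | succ k ih =>
    rcases hx with hx | ⟨y, hy, hx⟩
    · obtain ⟨t, s, h1, h2, h3, h4⟩ := ih hbx hxa hx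
      exact ⟨t, s + 1, by omega, by omega, h3, Or.inl h4⟩
    · have hx : Par x y := hx
      rcases lt_or_le_of_le (le_of_mem_relAnc hy) haρ with h1 | h1
      · obtain ⟨t, s, h2, h3, h4, h5⟩ := ih (hbx.trans hx.lt) h1 hy
        exact ⟨t, s + 1, by omega, by omega, h4, hx.mem_relAnc h5⟩
      · rcases h1.eq_or_lt with rfl | h1
        · exact ⟨k, 1, rfl, one_pos, hy, hx.mem_relAnc (self_mem_relAnc 0 _)⟩
        · exact (hab.not_cross hx hbx hxa h1).elim

/-- Iterated `+1`-edges lead back to the last node with a narrower stack. -/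
theorem mem_relAnc_of_wd_lt {b x : NPT N} (h : b < x) (hw : ∀ z, b < z → z ≤ x → wd b < wd z) :
    b ∈ relAnc (wd x - wd b) x := by
  induction hn : x.1.length using Nat.strong_induction_on generalizing x with
  | _ n ih =>
  subst hn
  have h1 := hw x h le_rfl
  obtain ⟨p, hp⟩ := exists_plusEdge (two_le_wd_of_lt h1)
  have h2 := hp.wd_eq
  obtain ⟨d, hd⟩ : ∃ d, wd x - wd b = d + 1 := ⟨wd x - wd b - 1, by omega⟩
  rw [hd]
  rcases lt_or_le_of_le h.le hp.lt.le with h3 | h3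
  · have h4 := ih _ (length_lt hp.lt) h3 (fun z hz hzp => hw z hz (hzp.trans hp.lt.le)) rfl
    have h5 := relAnc_trans h4 (hp.par.mem_relAnc (self_mem_relAnc 0 x))
    refine relAnc_mono ?_ _ h5
    omega
  · rcases h3.eq_or_lt with rfl | h3
    · exact relAnc_mono (by omega) _ (hp.par.mem_relAnc (self_mem_relAnc 0 x))
    · have := hp.wd_lt h3 h.le
      omega

/-- The distance estimate: relevant ancestors of `ρ` are relevant ancestors of each other, at
controlled depth. The only difficulty is an edge from `y` that passes over `x`. -/
theorem relAnc_of_le {k m : ℕ} {ρ x y : NPT N} (hy : y ∈ relAnc k ρ) (hx : x ∈ relAnc m ρ)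
    (hyx : y ≤ x) : y ∈ relAnc (k + m) x := by
  rcases hyx.eq_or_lt with rfl | hyx
  · exact self_mem_relAnc _ _
  induction k generalizing y with
  | zero =>
    obtain rfl : y = ρ := hy
    exact absurd (le_of_mem_relAnc hx) hyx.not_ge
  | succ k ih =>
    rcases hy with hy | ⟨z, hz, hy⟩
    · exact relAnc_mono (by omega) _ (ih hy hyx.le hyx)
    · have hy : Par y z := hy
      rcases lt_or_le_of_le (le_of_mem_relAnc hz) (le_of_mem_relAnc hx) with h1 | h1
      · exact relAnc_mono (by omega) _ (hy.mem_relAnc (ih hz h1.le h1))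
      · rcases h1.eq_or_lt with rfl | h1
        · exact relAnc_mono (by omega) _ (hy.mem_relAnc (self_mem_relAnc 0 _))
        -- The edge from `y` to `z` passes over `x`, so the path from `ρ` to `x` visits `z` and
        -- spends `s` steps below it. This bounds `wd x` by `wd z + s ≤ wd y + 1 + s`, and at most
        -- `s + 1` iterated `+1`-edges lead from `x` back to `y`.
        · obtain ⟨t, s, h2, h3, h4, h5⟩ := relAnc_through hy (le_of_mem_relAnc hz) hyx h1 hx
          have h6 := wd_le_of_mem_relAnc h5
          have h7 := hy.wd_between hyx h1
          refine relAnc_mono ?_ _ (mem_relAnc_of_wd_lt hyx fun v hv hvx =>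
            (hy.wd_between hv (hvx.trans_lt h1)).1)
          omega

theorem relAnc_le_total {k m : ℕ} {ρ x y : NPT N} (hy : y ∈ relAnc k ρ) (hx : x ∈ relAnc m ρ) :
    x < y ∨ y ≤ x := lt_or_le_of_le (le_of_mem_relAnc hx) (le_of_mem_relAnc hy)

/-- Neighbours in the linearly ordered set of relevant ancestors of a node are connected by an
edge. -/
theorem par_of_consecutive {l : ℕ} {ρ i j : NPT N} (hi : i ∈ relAnc l ρ) (hj : j ∈ relAnc l ρ)
    (hij : i < j) (hcons : ∀ z ∈ relAnc l ρ, z < j → z ≤ i) :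
    Par i j ∧ ∀ δ g, δ.op = .pop → Edge δ i j → Jump g j → g ∈ relAnc l ρ := by
  have hge : ∀ a ∈ relAnc l ρ, i < a → j ≤ a := fun a ha hia => by
    rcases relAnc_le_total hj ha with h | h
    · exact absurd (hcons a ha h) hia.not_ge
    · exact h
  obtain ⟨l, rfl⟩ : ∃ m, l = m + 1 := by
    cases l with
    | zero =>
      obtain rfl : i = ρ := hi
      obtain rfl : j = i := hj
      exact absurd hij (lt_irrefl _)
    | succ m => exact ⟨m, rfl⟩
  obtain ⟨a, ha, hia⟩ : ∃ a ∈ relAnc l ρ, Par i a := by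
    have hne : i ≠ ρ := (hij.trans_le (le_of_mem_relAnc hj)).ne
    clear hcons hge hj
    induction l with
    | zero =>
      rcases hi with hi | hi
      · exact absurd hi hne
      · exact hi
    | succ m ih =>
      rcases hi with hi | hi
      · obtain ⟨a, ha, h⟩ := ih hi
        exact ⟨a, relAnc_mono (Nat.le_succ _) _ ha, h⟩
      · exact hi
  refine ⟨?_, ?_⟩
  · have ha' := relAnc_mono (Nat.le_succ l) _ ha
    clear ha
    -- Descent on the target `a` of an edge from `i`: if `a` lies beyond `j`, the edge from `i` is
    -- replaced by one to a shorter relevant ancestor. Since `j` is reached through `a` in at least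
    -- one further step, all predecessors of `a` are relevant.
    induction hn : a.1.length using Nat.strong_induction_on generalizing a with
    | _ n ih =>
    subst hn
    rcases (hge a ha' hia.lt).eq_or_lt with rfl | hja
    · exact hia
    obtain ⟨t, s, h1, h2, h3, h4⟩ := relAnc_through hia (le_of_mem_relAnc ha') hij hja hj
    have hpar : ∀ z, Par z a → z ∈ relAnc (l + 1) ρ := fun z hz =>
      relAnc_mono (by omega) _ (hz.mem_relAnc h3)
    rcases hia with ⟨δ, _, hia⟩ | hia | hia
    · exact absurd (hia.le_of_lt hja) hij.not_ge
    · obtain ⟨z, δ, hE, hpop, hP⟩ := jump_iff.1 hia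
      exact ih _ (length_lt hE.lt) z hP.par (hpar z hE.par) rfl
    · obtain ⟨δ, z, hE⟩ := exists_edge (y := a) (by
        rintro rfl
        exact absurd (nil_le j) hja.not_ge)
      cases hop : δ.op with
      | push b =>
        obtain rfl := hia.unique (hE.plusEdge hop)
        exact absurd (hE.le_of_lt hja) hij.not_ge
      | pop =>
        obtain ⟨g, hg⟩ := exists_jump hE hop
        have hig := hg.plusEdge_iff.1 hia
        exact ih _ (length_lt hg.lt) g hig.par (hpar g hg.par) rfl
  · intro δ g hop hE hg
    rcases (hge a (relAnc_mono (Nat.le_succ l) _ ha) hia.lt).eq_or_lt with rfl | hja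
    · exact hg.par.mem_relAnc ha
    -- An edge passing over `j` forces `j` to be wider than `i`, which a pop from `i` to `j`
    -- forbids.
    · have := (hia.wd_between hij hja).1
      rw [hE.wd_pop hop] at this
      omega

open Classical in
theorem exists_finset_par (N : OnePS Q Γ) : ∃ F : NPT N → Finset (NPT N),
    ∀ y, (F y).card ≤ 3 ∧ ∀ x, Par x y → x ∈ F y := by
  have key : ∀ P : NPT N → Prop, (∀ x x', P x → P x' → x = x') →
      ∃ z, ∀ x, P x → x = z := by
    intro P hP
    by_cases h : ∃ z, P z
    · obtain ⟨z, hz⟩ := h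
      exact ⟨z, fun x hx => hP x z hx hz⟩
    · exact ⟨nil N, fun x hx => absurd ⟨x, hx⟩ h⟩
  choose e he using fun y : NPT N => key (fun x => ∃ δ ∈ N.trans, Edge δ x y) (by
    rintro x x' ⟨_, _, h⟩ ⟨_, _, h'⟩
    exact (h.unique h').1)
  choose j hj using fun y : NPT N => key (fun x => Jump x y) fun _ _ h h' => h.unique h'
  choose p hp using fun y : NPT N => key (fun x => PlusEdge x y) fun _ _ h h' => h.unique h'
  refine ⟨fun y => {e y, j y, p y}, fun y => ⟨Finset.card_le_three, fun x hx => ?_⟩⟩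
  simp only [Finset.mem_insert, Finset.mem_singleton]
  rcases hx with h | h | h
  · exact Or.inl (he y x h)
  · exact Or.inr (Or.inl (hj y x h))
  · exact Or.inr (Or.inr (hp y x h))

-- The base `4` counts a node together with its at most three predecessors.
open Classical in
theorem exists_finset_relAnc (l : ℕ) (ρ : NPT N) :
    ∃ F : Finset (NPT N), F.card ≤ 4 ^ l ∧ relAnc l ρ = F := by
  suffices ∃ F : Finset (NPT N), F.card ≤ 4 ^ l ∧ relAnc l ρ ⊆ F by
    obtain ⟨F, h1, h2⟩ := this
    have hfin := F.finite_toSet.subset h2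
    refine ⟨hfin.toFinset, (Finset.card_le_card ?_).trans h1, by simp⟩
    intro x hx
    exact h2 (by simpa using hx)
  obtain ⟨G, hG⟩ := exists_finset_par N
  induction l with
  | zero => exact ⟨{ρ}, by simp, fun x hx => Finset.mem_coe.2 (Finset.mem_singleton.2 hx)⟩
  | succ l ih =>
    obtain ⟨F, h1, h2⟩ := ih
    refine ⟨F ∪ F.biUnion G, ?_, ?_⟩
    · refine (Finset.card_union_le _ _).trans ?_
      have := Finset.card_biUnion_le_card_mul F G 3 fun y _ => (hG y).1
      rw [pow_succ]
      omega
    · rintro x (hx | ⟨y, hy, hx⟩)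
      · exact Finset.mem_coe.2 (Finset.mem_union_left _ (h2 hx))
      · exact Finset.mem_coe.2 (Finset.mem_union_right _
          (Finset.mem_biUnion.2 ⟨y, h2 hy, (hG y).2 x hx⟩))

end NPT

/-! ### Short words in context-free languages -/

section Grammar

variable {T A : Type*} {base : T → Prop} {r₁ : T → A → T → Prop} {r₂ : T → A → T → A → T → Prop}

/-- The words derived from the nonterminals of a context-free grammar whose rules have the forms
`t → ε`, `t → a t₁` and `t → a t₁ b t₂`. -/
inductive Derives (base : T → Prop) (r₁ : T → A → T → Prop) (r₂ : T → A → T → A → T → Prop) :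
    T → List A → Prop
  | nil {t} : base t → Derives base r₁ r₂ t []
  | one {t a t₁ w} : r₁ t a t₁ → Derives base r₁ r₂ t₁ w → Derives base r₁ r₂ t (a :: w)
  | two {t a t₁ b t₂ w v} : r₂ t a t₁ b t₂ → Derives base r₁ r₂ t₁ w → Derives base r₁ r₂ t₂ v →
      Derives base r₁ r₂ t (a :: (w ++ b :: v))

/-- `w` is a shortest word derived from `t`. -/
def IsShortest (base : T → Prop) (r₁ : T → A → T → Prop) (r₂ : T → A → T → A → T → Prop)
    (t : T) (w : List A) : Prop :=
  Derives base r₁ r₂ t w ∧ ∀ w', Derives base r₁ r₂ t w' → w.length ≤ w'.length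

/-- The parts of a shortest word are again shortest and strictly shorter, so the exponent drops for
each of them. The summand `2` absorbs the two letters of a branching rule: `|v| + |v'| + 4 = (|v| +
2) + (|v'| + 2)`. -/
theorem IsShortest.length_le [Finite T] {t : T} {w : List A} (h : IsShortest base r₁ r₂ t w) :
    w.length + 2 ≤ 2 ^ (1 + {t' | ∃ w', IsShortest base r₁ r₂ t' w' ∧
      w'.length < w.length}.ncard) := by
  induction hn : w.length using Nat.strong_induction_on generalizing t w with
  | _ n ih =>
  subst hn
  have key : ∀ t₁ w₁, IsShortest base r₁ r₂ t₁ w₁ → w₁.length < w.length →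
      2 * (w₁.length + 2) ≤ 2 ^ (1 + {t' | ∃ w', IsShortest base r₁ r₂ t' w' ∧
        w'.length < w.length}.ncard) := by
    intro t₁ w₁ h1 h2
    have h3 : {t' | ∃ w', IsShortest base r₁ r₂ t' w' ∧ w'.length < w₁.length}.ncard <
        {t' | ∃ w', IsShortest base r₁ r₂ t' w' ∧ w'.length < w.length}.ncard := by
      refine Set.ncard_lt_ncard ⟨?_, ?_⟩ (Set.toFinite _)
      · rintro t' ⟨w', h3, h4⟩
        exact ⟨w', h3, h4.trans h2⟩
      · intro h3
        obtain ⟨w', h4, h5⟩ := h3 ⟨w₁, h1, h2⟩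
        exact absurd (h1.2 w' h4.1) (not_le.2 h5)
    calc 2 * (w₁.length + 2) ≤ 2 * 2 ^ _ := Nat.mul_le_mul_left 2 (ih _ h2 h1 rfl)
      _ = 2 ^ (_ + 1) := (pow_succ' 2 _).symm
      _ ≤ _ := Nat.pow_le_pow_right two_pos (by omega)
  obtain ⟨h, hmin⟩ := h
  cases h with
  | nil _ => exact Nat.le_self_pow (by omega) 2
  | @one _ a t₁ v hr h1 =>
    have h2 : IsShortest base r₁ r₂ t₁ v := ⟨h1, fun w' hw' => by
      have := hmin _ (.one hr hw')
      simpa using this⟩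
    have := key t₁ v h2 (by simp)
    simp only [List.length_cons] at this ⊢
    omega
  | @two _ a t₁ b t₂ v v' hr h1 h1' =>
    have h2 : IsShortest base r₁ r₂ t₁ v := ⟨h1, fun w' hw' => by
      have := hmin _ (.two hr hw' h1')
      simpa using this⟩
    have h2' : IsShortest base r₁ r₂ t₂ v' := ⟨h1', fun w' hw' => by
      have := hmin _ (.two hr h1 hw')
      simpa using this⟩
    have h3 := key t₁ v h2 (by simp)
    have h4 := key t₂ v' h2' (by simp; omega)
    simp only [List.length_cons, List.length_append] at h3 h4 ⊢
    omega

theorem IsShortest.length_le_card [Finite T] {t : T} {w : List A}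
    (h : IsShortest base r₁ r₂ t w) : w.length + 2 ≤ 2 ^ (1 + Nat.card T) :=
  h.length_le.trans (Nat.pow_le_pow_right two_pos (Nat.add_le_add_left (Set.ncard_le_card _) 1))

/-- In a derivation of a word that is not shortest, some subderivation is not shortest although its
immediate parts are. Its word is then short, and replacing it by a shorter one loses a bounded
number of letters. -/
theorem Derives.shrink [Finite T] {t : T} {w : List A} (h : Derives base r₁ r₂ t w) :
    IsShortest base r₁ r₂ t w ∨ ∃ w', Derives base r₁ r₂ t w' ∧ w'.length < w.length ∧
      w.length ≤ w'.length + 2 ^ (2 + Nat.card T) := by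
  have key : ∀ {t w}, Derives base r₁ r₂ t w → w.length ≤ 2 ^ (2 + Nat.card T) →
      IsShortest base r₁ r₂ t w ∨ ∃ w', Derives base r₁ r₂ t w' ∧ w'.length < w.length ∧
      w.length ≤ w'.length + 2 ^ (2 + Nat.card T) := by
    intro t w h hw
    by_cases hs : ∀ w', Derives base r₁ r₂ t w' → w.length ≤ w'.length
    · exact Or.inl ⟨h, hs⟩
    · push Not at hs
      obtain ⟨w', h1, h2⟩ := hs
      exact Or.inr ⟨w', h1, h2, by omega⟩
  have hpow : 2 ^ (2 + Nat.card T) = 2 * 2 ^ (1 + Nat.card T) := by ring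
  induction h with
  | nil hb => exact key (.nil hb) (by simp)
  | @one t a t₁ v hr h1 ih =>
    rcases ih with h2 | ⟨w', h2, h3, h4⟩
    · refine key (.one hr h1) ?_
      have := h2.length_le_card
      simp
      omega
    · exact Or.inr ⟨_, .one hr h2, by simpa using h3, by simp; omega⟩
  | @two t a t₁ b t₂ v v' hr h1 h1' ih ih' =>
    rcases ih with h2 | ⟨w', h2, h3, h4⟩
    · rcases ih' with h2' | ⟨w', h2', h3, h4⟩
      · refine key (.two hr h1 h1') ?_
        have := h2.length_le_card
        have := h2'.length_le_card
        simp
        omega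
      · exact Or.inr ⟨_, .two hr h1 h2', by simpa using h3, by simp; omega⟩
    · exact Or.inr ⟨_, .two hr h2 h1', by simpa using h3, by simp; omega⟩

/-- A set of words derived from `t` that avoids `k` given words contains a short one. -/
theorem Derives.exists_short_notMem [Finite T] {t : T} {w : List A} {B : Set (List A)}
    (hB : B.Finite) (h : Derives base r₁ r₂ t w) (hw : w ∉ B) :
    ∃ w', Derives base r₁ r₂ t w' ∧ w' ∉ B ∧
      w'.length ≤ (B.ncard + 1) * 2 ^ (2 + Nat.card T) := by
  set E := 2 ^ (2 + Nat.card T) with hE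
  obtain ⟨v, ⟨hv, hvB⟩, hmin⟩ := WellFounded.has_min (measure (List.length (α := A))).wf
    {w | Derives base r₁ r₂ t w ∧ w ∉ B} ⟨w, h, hw⟩
  refine ⟨v, hv, hvB, ?_⟩
  by_contra! hlen
  -- Starting from a shortest admissible word `v`, repeated shrinking gives ever shorter words. By
  -- minimality of `v` all of them lie in `B`; if `v` is too long, this produces more distinct words
  -- than `B` contains.
  have key : ∀ i ≤ B.ncard + 1, ∃ F : Finset (List A), F.card = i ∧ (F : Set (List A)) ⊆ B ∧
      ∃ u, Derives base r₁ r₂ t u ∧ v.length ≤ u.length + i * E ∧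
        (i ≠ 0 → u ∈ F) ∧ u.length ≤ v.length ∧ ∀ u' ∈ F, u.length ≤ u'.length := by
    intro i
    induction i with
    | zero => exact fun _ => ⟨∅, rfl, by simp, v, hv, by simp, by simp, le_rfl, by simp⟩
    | succ i ih =>
      intro hi
      obtain ⟨F, h1, h2, u, h3, h4, h5, h6, h7⟩ := ih (by omega)
      have h8 : E < u.length := by
        have : (i + 1) * E ≤ (B.ncard + 1) * E := Nat.mul_le_mul_right _ hi
        rw [add_mul, one_mul] at this
        omega
      rcases h3.shrink with h9 | ⟨u', h9, h10, h11⟩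
      · have := h9.length_le_card
        rw [show 2 + Nat.card T = (1 + Nat.card T) + 1 by omega, pow_succ] at hE
        omega
      · have h12 : u' ∈ B := by
          by_contra h12
          exact hmin u' ⟨h9, h12⟩ (lt_of_lt_of_le h10 h6)
        have h13 : u' ∉ F := fun h => absurd (h7 u' h) (by omega)
        classical
        refine ⟨insert u' F, ?_, ?_, u', h9, ?_, by simp, by omega, ?_⟩
        · rw [Finset.card_insert_of_notMem h13, h1]
        · rw [Finset.coe_insert, Set.insert_subset_iff]
          exact ⟨h12, h2⟩
        · rw [add_mul, one_mul]
          omega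
        · intro u'' hu''
          rcases Finset.mem_insert.1 hu'' with rfl | hu''
          · exact le_rfl
          · exact h10.le.trans (h7 _ hu'')
  obtain ⟨F, h1, h2, _⟩ := key _ le_rfl
  have := Set.ncard_le_ncard h2 hB
  rw [Set.ncard_coe_finset] at this
  omega

end Grammar

/-! ### Runs along edges as context-free languages -/

section Runs

variable {Q Γ : Type*} {N : OnePS Q Γ}

/-- The kinds of runs described by the grammar: `ret q a q'` stands for the runs from `q` to `q'`
which start and end with the same stack, with topmost letter `a`, and in between do not remove this
letter; `jump q a q'` and `plus q a q' b` for those along jump edges and `+1`-edges, and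
`reach q a q' b` for all runs to state `q'` and topmost letter `b` not removing the letter `a`. -/
inductive RunType (Q Γ : Type*)
  | ret (q : Q) (a : Γ) (q' : Q)
  | jump (q : Q) (a : Γ) (q' : Q)
  | plus (q : Q) (a : Γ) (q' : Q) (b : Γ)
  | reach (q : Q) (a : Γ) (q' : Q) (b : Γ)
  | empty

namespace RunType

/-- An encoding of the types of runs. -/
def code : RunType Q Γ → Option (Fin 4 × Q × Γ × Q × Γ)
  | ret q a q' => some (0, q, a, q', a)
  | jump q a q' => some (1, q, a, q', a)
  | plus q a q' b => some (2, q, a, q', b)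
  | reach q a q' b => some (3, q, a, q', b)
  | empty => none

theorem code_injective : Function.Injective (code (Q := Q) (Γ := Γ)) := by
  rintro (_ | _ | _ | _ | _) (_ | _ | _ | _ | _) h <;> simp_all [code]

instance [Finite Q] [Finite Γ] : Finite (RunType Q Γ) := Finite.of_injective _ code_injective

theorem card_le [Fintype Q] [Fintype Γ] :
    Nat.card (RunType Q Γ) ≤ 4 * (Fintype.card Q + Fintype.card Γ) ^ 4 + 1 := by
  refine (Nat.card_le_card_of_injective _ code_injective).trans ?_
  simp only [Nat.card_eq_fintype_card, Fintype.card_option, Fintype.card_prod, Fintype.card_fin]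
  have hq : Fintype.card Q ≤ Fintype.card Q + Fintype.card Γ := by omega
  have hg : Fintype.card Γ ≤ Fintype.card Q + Fintype.card Γ := by omega
  have := Nat.mul_le_mul hq (Nat.mul_le_mul hg (Nat.mul_le_mul hq hg))
  refine Nat.succ_le_succ (Nat.mul_le_mul_left 4 (this.trans (le_of_eq ?_)))
  ring

/-- The types of runs which contain the run of length zero. -/
inductive Base : RunType Q Γ → Prop
  | ret (q : Q) (a : Γ) : Base (ret q a q)
  | reach (q : Q) (a : Γ) : Base (reach q a q a)
  | empty : Base empty

/-- Runs whose first transition is never undone. -/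
inductive RuleOne (N : OnePS Q Γ) : RunType Q Γ → Transition Q Γ → RunType Q Γ → Prop
  | plus {δ b} (q') (hδ : δ ∈ N.trans) (h : δ.op = .push b) :
      RuleOne N (plus δ.source δ.symbol q' b) δ (ret δ.target b q')
  | reach {δ b} (q' c) (hδ : δ ∈ N.trans) (h : δ.op = .push b) :
      RuleOne N (reach δ.source δ.symbol q' c) δ (reach δ.target b q' c)

/-- Runs whose first transition is undone by a later one. -/
inductive RuleTwo (N : OnePS Q Γ) :
    RunType Q Γ → Transition Q Γ → RunType Q Γ → Transition Q Γ → RunType Q Γ → Prop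
  | ret {δ ε b} (q') (hδ : δ ∈ N.trans) (h : δ.op = .push b) (hε : ε ∈ N.trans)
      (h' : ε.op = .pop) (hb : ε.symbol = b) : RuleTwo N (ret δ.source δ.symbol q') δ
        (ret δ.target b ε.source) ε (ret ε.target δ.symbol q')
  | jump {δ ε b} (hδ : δ ∈ N.trans) (h : δ.op = .push b) (hε : ε ∈ N.trans)
      (h' : ε.op = .pop) (hb : ε.symbol = b) : RuleTwo N (jump δ.source δ.symbol ε.target) δ
        (ret δ.target b ε.source) ε empty
  | reach {δ ε b} (q' c) (hδ : δ ∈ N.trans) (h : δ.op = .push b) (hε : ε ∈ N.trans)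
      (h' : ε.op = .pop) (hb : ε.symbol = b) : RuleTwo N (reach δ.source δ.symbol q' c) δ
        (ret δ.target b ε.source) ε (reach ε.target δ.symbol q' c)

/-- The words of transitions of the runs of a given type. -/
abbrev Lang (N : OnePS Q Γ) : RunType Q Γ → List (Transition Q Γ) → Prop :=
  Derives Base (RuleOne N) (RuleTwo N)

/-- The meaning of the types of runs, relative to the letters `s` below the topmost one. -/
def Sem (N : OnePS Q Γ) (s : List Γ) (u : List (Transition Q Γ)) : RunType Q Γ → Prop
  | ret q a q' => ExecAbove N (s.length + 1) (cfg q a s) u (cfg q' a s)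
  | jump q a q' => ∃ v ε δ w b b' c, u = v ++ [ε] ∧ ε.op = .pop ∧ v = δ :: w ∧ δ.op = .push b' ∧
      N.Step δ (cfg q a s) c ∧ ExecAbove N (s.length + 2) c w (cfg ε.source b (a :: s)) ∧
      N.Step ε (cfg ε.source b (a :: s)) (cfg q' a s)
  | plus q a q' b => ∃ δ w b' c, u = δ :: w ∧ δ.op = .push b' ∧
      N.Step δ (cfg q a s) c ∧ ExecAbove N (s.length + 2) c w (cfg q' b (a :: s))
  | reach q a q' b => ∃ s', ExecAbove N (s.length + 1) (cfg q a s) u (cfg q' b s')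
  | empty => u = []

theorem _root_.NestedPushdown.step_push {δ : Transition Q Γ} {b : Γ} (hδ : δ ∈ N.trans)
    (h : δ.op = .push b) (s : List Γ) :
    N.Step δ (cfg δ.source δ.symbol s) (cfg δ.target b (δ.symbol :: s)) :=
  step_iff.2 ⟨hδ, Or.inl ⟨b, s, h, rfl, rfl⟩⟩

theorem _root_.NestedPushdown.step_pop {δ : Transition Q Γ} (hδ : δ ∈ N.trans)
    (h : δ.op = .pop) (b : Γ) (s : List Γ) :
    N.Step δ (cfg δ.source δ.symbol (b :: s)) (cfg δ.target b s) :=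
  step_iff.2 ⟨hδ, Or.inr ⟨b, s, h, rfl, rfl⟩⟩

theorem Lang.sem {t : RunType Q Γ} {u : List (Transition Q Γ)} (h : Lang N t u) :
    ∀ s, Sem N s u t := by
  induction h with
  | nil hb =>
    intro s
    cases hb with
    | ret q a => exact ⟨le_rfl, rfl⟩
    | reach q a => exact ⟨s, le_rfl, rfl⟩
    | empty => rfl
  | @one t a t₁ w hr h1 ih =>
    intro s
    cases hr with
    | plus q' hδ h => exact ⟨a, _, _, _, rfl, h, step_push hδ h s, ih (a.symbol :: s)⟩
    | reach q' c hδ h =>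
      obtain ⟨s', hs'⟩ := ih (a.symbol :: s)
      exact ⟨s', le_rfl, _, step_push hδ h s, hs'.mono (by simp)⟩
  | @two t a t₁ b t₂ w v hr h1 h2 ih1 ih2 =>
    intro s
    cases hr with
    | ret q' hδ h hε h' hb =>
      subst hb
      exact ⟨le_rfl, _, step_push hδ h s, ExecAbove.append_iff.2 ⟨_, (ih1 _).mono (by simp),
        by simp, _, step_pop hε h' _ s, ih2 s⟩⟩
    | jump hδ h hε h' hb =>
      subst hb
      obtain rfl : v = [] := ih2 s
      exact ⟨_, b, a, w, b.symbol, _, _, rfl, h', rfl, h, step_push hδ h s, ih1 (a.symbol :: s),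
        step_pop hε h' _ s⟩
    | reach q' c hδ h hε h' hb =>
      subst hb
      obtain ⟨s', hs'⟩ := ih2 s
      exact ⟨s', le_rfl, _, step_push hδ h s, ExecAbove.append_iff.2 ⟨_, (ih1 _).mono (by simp),
        by simp, _, step_pop hε h' _ s, hs'⟩⟩

/-- The first transition is a push. Either its letter is never removed, or the run splits at the
first pop that removes it. Both types are treated together because the part before this pop must be
recognised as a returning run. -/
theorem lang_of_exec {q : Q} {a : Γ} {s : List Γ} {u : List (Transition Q Γ)} {c : Config Q Γ}
    (h : ExecAbove N (s.length + 1) (cfg q a s) u c) : ∃ q' b s', c = cfg q' b s' ∧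
      Lang N (reach q a q' b) u ∧
      (s'.length = s.length → b = a ∧ s' = s ∧ Lang N (ret q a q') u) := by
  induction hn : u.length using Nat.strong_induction_on generalizing q a s u c with
  | _ n ih =>
  subst hn
  cases u with
  | nil =>
    obtain ⟨_, rfl⟩ := h
    exact ⟨q, a, s, rfl, .nil (.reach q a), fun _ => ⟨rfl, rfl, .nil (.ret q a)⟩⟩
  | cons δ u =>
    obtain ⟨_, c₁, h1, h2⟩ := h
    obtain ⟨hδ, ⟨b, t, h3, h4, rfl⟩ | ⟨b, t, h3, h4, rfl⟩⟩ := step_iff.1 h1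
    · obtain ⟨rfl, rfl, rfl⟩ := cfg_inj.1 h4
      rcases h2.split (k := (δ.symbol :: s).length + 1) le_rfl with
        h5 | ⟨u₁, ε, u₂, d₁, d₂, rfl, h5, h6, h7, h8⟩
      · obtain ⟨q', b', s', rfl, h6, _⟩ := ih _ (by simp) h5 rfl
        refine ⟨q', b', s', rfl, .one (.reach q' b' hδ h3) h6, fun h7 => ?_⟩
        have := h5.le_right
        simp at this
        omega
      · obtain ⟨q₂, b₂, s₂, rfl, _, h9⟩ := ih _ (by simp) h5 rfl
        have h10 := h5.le_right
        obtain ⟨hε, ⟨x, t', h11, h12, rfl⟩ | ⟨x, t', h11, h12, rfl⟩⟩ := step_iff.1 h6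
        · obtain ⟨rfl, rfl, rfl⟩ := cfg_inj.1 h12
          simp at h7 h10
          omega
        · obtain ⟨rfl, rfl, rfl⟩ := cfg_inj.1 h12
          obtain ⟨h13, h14, h15⟩ := h9 (by simp at h7 h10 ⊢; omega)
          simp only [List.cons.injEq] at h14
          obtain ⟨rfl, rfl⟩ := h14
          obtain ⟨q', b', s', rfl, h16, h17⟩ := ih _ (by simp; omega) h8 rfl
          refine ⟨q', b', s', rfl, .two (.reach q' b' hδ h3 hε h11 h13) h15 h16, fun h18 => ?_⟩
          obtain ⟨rfl, rfl, h19⟩ := h17 h18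
          exact ⟨rfl, rfl, .two (.ret q' hδ h3 hε h11 h13) h15 h19⟩
    · obtain ⟨rfl, rfl, rfl⟩ := cfg_inj.1 h4
      have := h2.le_left
      simp at this

end RunType

namespace NPT

/-- The final state of a node. -/
abbrev st (x : NPT N) : Q := x.1.last.state

/-- The topmost letter of the final stack of a node. -/
abbrev tp (x : NPT N) : Γ := x.1.last.stack.top

theorem st_tp_of_last {x : NPT N} {q : Q} {a : Γ} {s : List Γ} (h : x.1.last = cfg q a s) :
    st x = q ∧ tp x = a := by
  unfold st tp
  rw [h]
  exact ⟨rfl, rfl⟩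

theorem exists_last_eq (x : NPT N) : ∃ s, x.1.last = cfg (st x) (tp x) s := by
  obtain ⟨q, a, s, h⟩ := exists_eq_cfg x.1.last
  exact ⟨s, by simp [st, tp, h]⟩

theorem PlusEdge.lang {x y : NPT N} (h : PlusEdge x y) : ∃ u, word y = word x ++ u ∧
    RunType.Lang N (.plus (st x) (tp x) (st y) (tp y)) u := by
  obtain ⟨h1, δ, b, u, c, h2, h3, h4, h5⟩ := plusEdge_iff_exec.1 h
  refine ⟨δ :: u, h2, ?_⟩
  obtain ⟨s, hs⟩ := exists_last_eq x
  obtain ⟨hδ, ⟨b', t, h6, h7, rfl⟩ | ⟨b', t, h6, h7, rfl⟩⟩ := step_iff.1 h3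
  · have hw : wd x = t.length + 1 := by simp [wd, h7]
    rw [hw] at h5
    obtain ⟨q', b'', s', h8, _, h9⟩ := RunType.lang_of_exec (s := δ.symbol :: t) h5
    obtain ⟨h10, rfl, h11⟩ := h9 (by
      have : wd y = s'.length + 1 := by simp [wd, h8]
      simp
      omega)
    subst h10
    rw [(st_tp_of_last h7).1, (st_tp_of_last h7).2, (st_tp_of_last h8).1, (st_tp_of_last h8).2]
    exact .one (.plus q' hδ h6) h11
  · exact absurd (h4.symm.trans h6) (by simp)

theorem exists_plusEdge_of_lang {x : NPT N} {q' : Q} {b : Γ} {u : List (Transition Q Γ)}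
    (h : RunType.Lang N (.plus (st x) (tp x) q' b) u) :
    ∃ y, word y = word x ++ u ∧ PlusEdge x y ∧ st y = q' ∧ tp y = b := by
  obtain ⟨s, hs⟩ := exists_last_eq x
  obtain ⟨δ, w, b', c, rfl, h1, h2, h3⟩ := h.sem s
  rw [← hs] at h2
  obtain ⟨y, hy, hy'⟩ := exists_append (x := x) (u := δ :: w) (c := cfg q' b (tp x :: s))
    ⟨Nat.zero_le _, c, h2, h3.mono (Nat.zero_le _)⟩
  have hw : wd x = s.length + 1 := by simp [wd, hs]
  refine ⟨y, hy, plusEdge_iff_exec.2 ⟨by simp [wd, hs, hy'], δ, b', w, c, hy, h2, h1, ?_⟩,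
    (st_tp_of_last hy').1, (st_tp_of_last hy').2⟩
  rw [hw, hy']
  exact h3

theorem Jump.tp_eq {x y : NPT N} (h : Jump x y) : tp y = tp x := by
  simp only [tp, h.stack_eq]

theorem Jump.lang {x y : NPT N} (h : Jump x y) : ∃ u, word y = word x ++ u ∧
    RunType.Lang N (.jump (st x) (tp x) (st y)) u := by
  obtain ⟨z, ε, h1, h2, h3⟩ := jump_iff.1 h
  obtain ⟨u, h4, h5⟩ := h3.lang
  refine ⟨u ++ [ε], by rw [edge_iff.1 h1, h4]; simp, ?_⟩
  have hstep := h1.step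
  obtain ⟨hε, ⟨b', t, h6, h7, h8⟩ | ⟨b', t, h6, h7, h8⟩⟩ := step_iff.1 hstep
  · exact absurd (h2.symm.trans h6) (by simp)
  · have e1 : st z = ε.source := (st_tp_of_last h7).1
    have e2 : tp z = ε.symbol := (st_tp_of_last h7).2
    have e3 : st y = ε.target := (st_tp_of_last h8).1
    rw [e1, e2] at h5
    rw [e3]
    generalize st x = q at *
    generalize tp x = a at *
    cases h5 with
    | nil hb => cases hb
    | one hr h9 =>
      cases hr with
      | plus _ hδ hp =>
        exact .two (.jump hδ hp hε h2 rfl) h9 (.nil .empty)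
    | two hr => cases hr

theorem exists_jump_of_lang {x : NPT N} {q' : Q} {u : List (Transition Q Γ)}
    (h : RunType.Lang N (.jump (st x) (tp x) q') u) :
    ∃ y, word y = word x ++ u ∧ Jump x y ∧ st y = q' ∧ tp y = tp x := by
  obtain ⟨s, hs⟩ := exists_last_eq x
  obtain ⟨v, ε, δ, w, b, b', c, rfl, h1, rfl, h2, h3, h4, h5⟩ := h.sem s
  rw [← hs] at h3
  have hw : wd x = s.length + 1 := by simp [wd, hs]
  obtain ⟨z, hz, hz'⟩ := exists_append (x := x) (u := δ :: w) (c := cfg ε.source b (tp x :: s))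
    ⟨Nat.zero_le _, c, h3, h4.mono (Nat.zero_le _)⟩
  have hP : PlusEdge x z := plusEdge_iff_exec.2
    ⟨by simp [wd, hs, hz'], δ, b', w, c, hz, h3, h2, by rw [hw, hz']; exact h4⟩
  rw [← hz'] at h5
  obtain ⟨y, hy, hy'⟩ := exists_append (.single h5)
  have hJ := (edge_iff.2 hy).jump h1 hP
  exact ⟨y, by rw [hy, hz]; simp, hJ, (st_tp_of_last hy').1, hJ.tp_eq⟩

theorem reach_lang (x : NPT N) :
    RunType.Lang N (.reach N.init N.bot (st x) (tp x)) (word x) := by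
  obtain ⟨q', b, s', h1, h2, _⟩ := RunType.lang_of_exec (s := [])
    ((exec_iff_wd (x := nil N) (y := x) (u := word x) (k := 1) (by simp)).2
      fun z _ _ => one_le_wd z)
  rw [(st_tp_of_last h1).1, (st_tp_of_last h1).2]
  exact h2

theorem exists_of_reach_lang {q' : Q} {b : Γ} {u : List (Transition Q Γ)}
    (h : RunType.Lang N (.reach N.init N.bot q' b) u) :
    ∃ y : NPT N, word y = u ∧ st y = q' ∧ tp y = b := by
  obtain ⟨s', h1⟩ := h.sem []
  obtain ⟨y, hy, hy'⟩ := exists_word (N := N) (h1.mono (Nat.zero_le _))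
  exact ⟨y, hy, st_tp_of_last hy'⟩

end NPT

end Runs

end NestedPushdown

/-! ### Maps preserving labels and incoming edges -/

namespace NestedPushdown
variable {Q Γ : Type*} {N : OnePS Q Γ}
namespace NPT

/-- `ψ` preserves the labels of the nodes in `D` and the edges to nodes in `D`. -/
structure IsLocal (D : Set (NPT N)) (ψ : NPT N → NPT N) : Prop where
  edge : ∀ {δ x y}, y ∈ D → Edge δ x y → Edge δ (ψ x) (ψ y)
  jump : ∀ {x y}, y ∈ D → Jump x y → Jump (ψ x) (ψ y)
  plus : ∀ {x y}, y ∈ D → PlusEdge x y → PlusEdge (ψ x) (ψ y)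
  label : ∀ {y}, y ∈ D → st (ψ y) = st y ∧ tp (ψ y) = tp y
  nil : nil N ∈ D → ψ (nil N) = nil N

namespace IsLocal

variable {D : Set (NPT N)} {ψ : NPT N → NPT N} {x y ρ : NPT N}

theorem mono (h : IsLocal D ψ) {D' : Set (NPT N)} (hD : D' ⊆ D) : IsLocal D' ψ where
  edge hy := h.edge (hD hy)
  jump hy := h.jump (hD hy)
  plus hy := h.plus (hD hy)
  label hy := h.label (hD hy)
  nil hy := h.nil (hD hy)

theorem par (h : IsLocal D ψ) (hy : y ∈ D) (hx : Par x y) : Par (ψ x) (ψ y) := by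
  rcases hx with ⟨δ, _, hx⟩ | hx | hx
  · exact (h.edge hy hx).par
  · exact (h.jump hy hx).par
  · exact (h.plus hy hx).par

/-- Reflection from uniqueness: `y` has some incoming edge, and its image is the only incoming edge
of `ψ y`. The run of length zero has none, hence the condition that it be fixed. -/
theorem exists_edge_of_edge (h : IsLocal D ψ) (hy : y ∈ D) {δ : Transition Q Γ} {x' : NPT N}
    (hx : Edge δ x' (ψ y)) : ∃ x, Edge δ x y ∧ ψ x = x' := by
  obtain ⟨ε, z, hz⟩ := exists_edge (y := y) (by
    rintro rfl
    rw [h.nil hy] at hx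
    exact not_edge_nil hx)
  obtain ⟨h1, rfl⟩ := (h.edge hy hz).unique hx
  exact ⟨z, hz, h1⟩

theorem exists_plusEdge_of_plusEdge (h : IsLocal D ψ) (hy : y ∈ D) {x' : NPT N}
    (hx : PlusEdge x' (ψ y)) : ∃ x, PlusEdge x y ∧ ψ x = x' := by
  have h1 : 2 ≤ wd (ψ y) := two_le_wd_of_lt (hx.wd_lt hx.lt le_rfl)
  rw [two_le_wd_iff] at h1
  have h2 : tp y ≠ N.bot := by
    rw [← (h.label hy).2]
    exact h1
  obtain ⟨z, hz⟩ := exists_plusEdge ((two_le_wd_iff y).2 h2)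
  exact ⟨z, hz, (h.plus hy hz).unique hx⟩

theorem exists_jump_of_jump (h : IsLocal D ψ) (hy : y ∈ D) {x' : NPT N}
    (hx : Jump x' (ψ y)) : ∃ x, Jump x y ∧ ψ x = x' := by
  obtain ⟨z', δ, h1, h2, _⟩ := jump_iff.1 hx
  obtain ⟨z, hz, _⟩ := h.exists_edge_of_edge hy h1
  obtain ⟨x, hx'⟩ := exists_jump hz h2
  exact ⟨x, hx', (h.jump hy hx').unique hx⟩

theorem exists_par_of_par (h : IsLocal D ψ) (hy : y ∈ D) {x' : NPT N} (hx : Par x' (ψ y)) :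
    ∃ x, Par x y ∧ ψ x = x' := by
  rcases hx with ⟨δ, _, hx⟩ | hx | hx
  · obtain ⟨x, h1, h2⟩ := h.exists_edge_of_edge hy hx
    exact ⟨x, h1.par, h2⟩
  · obtain ⟨x, h1, h2⟩ := h.exists_jump_of_jump hy hx
    exact ⟨x, h1.par, h2⟩
  · obtain ⟨x, h1, h2⟩ := h.exists_plusEdge_of_plusEdge hy hx
    exact ⟨x, h1.par, h2⟩

theorem mem_relAnc (h : IsLocal D ψ) {l k : ℕ} (hD : relAnc l ρ ⊆ D) (hk : k ≤ l + 1)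
    (hx : x ∈ relAnc k ρ) : ψ x ∈ relAnc k (ψ ρ) := by
  induction k generalizing x with
  | zero => exact congrArg ψ hx
  | succ k ih =>
    rcases hx with hx | ⟨y, hy, hx⟩
    · exact Or.inl (ih (by omega) hx)
    · exact Or.inr ⟨ψ y, ih (by omega) hy, h.par (hD (relAnc_mono (by omega) _ hy)) hx⟩

theorem exists_of_mem_relAnc (h : IsLocal D ψ) {l k : ℕ} (hD : relAnc l ρ ⊆ D) (hk : k ≤ l + 1)
    {x' : NPT N} (hx : x' ∈ relAnc k (ψ ρ)) : ∃ x ∈ relAnc k ρ, ψ x = x' := by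
  induction k generalizing x' with
  | zero => exact ⟨ρ, rfl, Eq.symm hx⟩
  | succ k ih =>
    rcases hx with hx | ⟨y', hy, hx⟩
    · obtain ⟨x, h1, h2⟩ := ih (by omega) hx
      exact ⟨x, Or.inl h1, h2⟩
    · obtain ⟨y, h1, rfl⟩ := ih (by omega) hy
      obtain ⟨x, h2, h3⟩ := h.exists_par_of_par (hD (relAnc_mono (by omega) _ h1)) hx
      exact ⟨x, Or.inr ⟨y, h1, h2⟩, h3⟩

end IsLocal

theorem mem_relAncTuple {l n : ℕ} {ρs : Fin n → NPT N} {x : NPT N} :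
    x ∈ relAncTuple l ρs ↔ ∃ i, x ∈ relAnc l (ρs i) := Set.mem_iUnion

theorem relAncTuple_mono {k l n : ℕ} (h : k ≤ l) (ρs : Fin n → NPT N) :
    relAncTuple k ρs ⊆ relAncTuple l ρs :=
  Set.iUnion_mono fun _ => relAnc_mono h _

theorem Par.mem_relAncTuple {l n : ℕ} {ρs : Fin n → NPT N} {x y : NPT N} (h : Par x y)
    (hy : y ∈ relAncTuple l ρs) : x ∈ relAncTuple (l + 1) ρs := by
  obtain ⟨i, hi⟩ := NPT.mem_relAncTuple.1 hy
  exact NPT.mem_relAncTuple.2 ⟨i, h.mem_relAnc hi⟩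

/-- Edges are reflected by lifting the predecessor of an image and identifying the lift with the
given source. The lift may lie one level further out, so injectivity is needed on level `l + 1`. -/
theorem IsLocal.ancEquiv {l n : ℕ} {ρs ρs' : Fin n → NPT N} {ψ : NPT N → NPT N}
    (h : IsLocal (relAncTuple l ρs) ψ) (h₀ : ∀ i, ψ (ρs i) = ρs' i)
    (hinj : Set.InjOn ψ (relAncTuple (l + 1) ρs)) : AncEquiv l ρs ρs' := by
  have hD : ∀ i, relAnc l (ρs i) ⊆ relAncTuple l ρs := fun i x hx => mem_relAncTuple.2 ⟨i, hx⟩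
  have hmem : ∀ k ≤ l, ∀ i x, x ∈ relAnc k (ρs i) → ψ x ∈ relAnc k (ρs' i) := fun k hk i x hx => by
    rw [← h₀]
    exact h.mem_relAnc (hD i) (by omega) hx
  have hsub := relAncTuple_mono (Nat.le_succ l) ρs
  have hmaps : ∀ x ∈ relAncTuple l ρs, ψ x ∈ relAncTuple l ρs' := fun x hx => by
    obtain ⟨i, hi⟩ := mem_relAncTuple.1 hx
    exact mem_relAncTuple.2 ⟨i, hmem l le_rfl i x hi⟩
  have hbij : Function.Bijective
      (fun x : relAncTuple l ρs => (⟨ψ x.1, hmaps x.1 x.2⟩ : relAncTuple l ρs')) := by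
    constructor
    · intro x y hxy
      exact Subtype.ext (hinj (hsub x.2) (hsub y.2) (congrArg Subtype.val hxy))
    · rintro ⟨y, hy⟩
      obtain ⟨i, hi⟩ := mem_relAncTuple.1 hy
      rw [← h₀] at hi
      obtain ⟨x, h1, h2⟩ := h.exists_of_mem_relAnc (hD i) (Nat.le_succ l) hi
      exact ⟨⟨x, hD i h1⟩, Subtype.ext h2⟩
  refine ⟨Equiv.ofBijective _ hbij, fun k hk i π hπ => hmem k hk i π.1 hπ, ?_, ?_, ?_, ?_⟩
  · intro δ _ x y
    refine ⟨h.edge y.2, fun hxy => ?_⟩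
    obtain ⟨z, h1, h2⟩ := h.exists_edge_of_edge y.2 hxy
    rwa [← hinj (h1.par.mem_relAncTuple y.2) (hsub x.2) h2]
  · intro x y
    refine ⟨h.jump y.2, fun hxy => ?_⟩
    obtain ⟨z, h1, h2⟩ := h.exists_jump_of_jump y.2 hxy
    rwa [← hinj (h1.par.mem_relAncTuple y.2) (hsub x.2) h2]
  · intro x y
    refine ⟨h.plus y.2, fun hxy => ?_⟩
    obtain ⟨z, h1, h2⟩ := h.exists_plusEdge_of_plusEdge y.2 hxy
    rwa [← hinj (h1.par.mem_relAncTuple y.2) (hsub x.2) h2]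
  · exact fun x => h.label x.2

-- One level is spent so that predecessors of nodes on level `l` are still in the domain of the
-- bijection.
open Classical in
theorem AncEquiv.exists_isLocal {l n : ℕ} {ρs ρs' : Fin n → NPT N}
    (h : AncEquiv (l + 1) ρs ρs') : ∃ φ : NPT N → NPT N, IsLocal (relAncTuple l ρs) φ ∧
      (∀ i, φ (ρs i) = ρs' i) ∧ Set.InjOn φ (relAncTuple (l + 1) ρs) := by
  obtain ⟨f, h1, hE, hJ, hP, hL⟩ := h
  set φ : NPT N → NPT N := fun x => if hx : x ∈ relAncTuple (l + 1) ρs then (f ⟨x, hx⟩).1 else x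
  have hφ : ∀ x (hx : x ∈ relAncTuple (l + 1) ρs), φ x = (f ⟨x, hx⟩).1 := fun x hx => dif_pos hx
  have hsub := relAncTuple_mono (Nat.le_succ l) ρs
  have hpar : ∀ {x y}, Par x y → y ∈ relAncTuple l ρs → x ∈ relAncTuple (l + 1) ρs :=
    fun h hy => h.mem_relAncTuple hy
  have hroot : ∀ i, φ (ρs i) = ρs' i := fun i => by
    have hi : ρs i ∈ relAncTuple (l + 1) ρs := mem_relAncTuple.2 ⟨i, self_mem_relAnc _ _⟩
    rw [hφ _ hi]
    exact h1 0 (Nat.zero_le _) i ⟨_, hi⟩ rfl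
  refine ⟨φ, ⟨?_, ?_, ?_, ?_, ?_⟩, hroot, ?_⟩
  · intro δ x y hy hxy
    rw [hφ x (hpar hxy.par hy), hφ y (hsub hy)]
    exact (hE δ hxy.mem _ _).1 hxy
  · intro x y hy hxy
    rw [hφ x (hpar hxy.par hy), hφ y (hsub hy)]
    exact (hJ _ _).1 hxy
  · intro x y hy hxy
    rw [hφ x (hpar hxy.par hy), hφ y (hsub hy)]
    exact (hP _ _).1 hxy
  · intro y hy
    rw [hφ y (hsub hy)]
    exact hL ⟨y, hsub hy⟩
  · intro hy
    rw [hφ _ (hsub hy)]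
    -- An incoming edge of the image would start at a relevant ancestor and pull back to an incoming
    -- edge of the run of length zero.
    by_contra hne
    obtain ⟨δ, z, hz⟩ := exists_edge hne
    obtain ⟨i, hi⟩ := mem_relAncTuple.1 hy
    have h2 := h1 l (Nat.le_succ l) i ⟨_, hsub hy⟩ hi
    have h3 : z ∈ relAncTuple (l + 1) ρs' := mem_relAncTuple.2 ⟨i, hz.par.mem_relAnc h2⟩
    have h4 := (hE δ hz.mem (f.symm ⟨z, h3⟩) ⟨_, hsub hy⟩).2 (by rw [Equiv.apply_symm_apply]; exact hz)
    exact not_edge_nil h4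
  · intro x hx y hy hxy
    rw [hφ x hx, hφ y hy] at hxy
    exact congrArg Subtype.val (f.injective (Subtype.ext hxy))

/-! ### Adjoining the run of length zero -/

/-- The relevant ancestors of a tuple, together with the run of length zero. -/
def relAncNil (l : ℕ) {n : ℕ} (ρs : Fin n → NPT N) : Set (NPT N) :=
  insert (nil N) (relAncTuple l ρs)

theorem relAncNil_mono {k l n : ℕ} (h : k ≤ l) (ρs : Fin n → NPT N) :
    relAncNil k ρs ⊆ relAncNil l ρs := Set.insert_subset_insert (relAncTuple_mono h ρs)

theorem nil_mem_relAncNil (l : ℕ) {n : ℕ} (ρs : Fin n → NPT N) : nil N ∈ relAncNil l ρs :=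
  Set.mem_insert _ _

theorem relAncNil_trans {k l n : ℕ} {ρs : Fin n → NPT N} {x y : NPT N} (hx : x ∈ relAnc k y)
    (hy : y ∈ relAncNil l ρs) : x ∈ relAncNil (l + k) ρs := by
  rcases hy with rfl | hy
  · rw [le_antisymm (le_of_mem_relAnc hx) (nil_le x)]
    exact nil_mem_relAncNil _ _
  · obtain ⟨i, hi⟩ := mem_relAncTuple.1 hy
    exact Or.inr (mem_relAncTuple.2 ⟨i, relAnc_trans hx hi⟩)

theorem Par.mem_relAncNil {l n : ℕ} {ρs : Fin n → NPT N} {x y : NPT N} (h : Par x y)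
    (hy : y ∈ relAncNil l ρs) : x ∈ relAncNil (l + 1) ρs :=
  relAncNil_trans (h.mem_relAnc (self_mem_relAnc 0 y)) hy

theorem exists_finset_relAncNil (l : ℕ) {n : ℕ} (ρs : Fin n → NPT N) :
    ∃ F : Finset (NPT N), F.card ≤ n * 4 ^ l + 1 ∧ relAncNil l ρs = F := by
  classical
  choose F hF using fun i => exists_finset_relAnc l (ρs i)
  refine ⟨insert (nil N) (Finset.univ.biUnion F), ?_, ?_⟩
  · refine (Finset.card_insert_le _ _).trans (Nat.succ_le_succ ?_)
    have := Finset.card_biUnion_le_card_mul Finset.univ F (4 ^ l) fun i _ => (hF i).1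
    simpa using this
  · ext x
    simp [relAncNil, mem_relAncTuple, fun i => (hF i).2]

-- A second level is spent on showing that no other node is sent to the run of length zero, so that
-- adjoining it keeps the map injective.
open Classical in
theorem AncEquiv.exists_isLocal_nil {l n : ℕ} {ρs ρs' : Fin n → NPT N}
    (h : AncEquiv (l + 2) ρs ρs') : ∃ φ : NPT N → NPT N, IsLocal (relAncNil l ρs) φ ∧
      (∀ i, φ (ρs i) = ρs' i) ∧ Set.InjOn φ (relAncNil (l + 1) ρs) := by
  obtain ⟨φ, hφ, h0, hinj⟩ := h.exists_isLocal
  set ψ : NPT N → NPT N := fun x => if x = nil N then nil N else φ x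
  have hnil : ψ (nil N) = nil N := if_pos rfl
  have hψ : ∀ x ∈ relAncTuple (l + 1) ρs, ψ x = φ x := by
    intro x hx
    by_cases h1 : x = nil N
    · subst h1
      rw [hnil, hφ.nil hx]
    · exact if_neg h1
  have hsub := relAncTuple_mono (Nat.le_succ l) ρs
  have hsub' := relAncTuple_mono (Nat.le_succ (l + 1)) ρs
  refine ⟨ψ, ⟨?_, ?_, ?_, ?_, fun _ => hnil⟩, fun i => ?_, ?_⟩
  · rintro δ x y (rfl | hy) hxy
    · exact absurd hxy not_edge_nil
    · rw [hψ y (hsub hy), hψ x (hxy.par.mem_relAncTuple hy)]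
      exact hφ.edge (hsub hy) hxy
  · rintro x y (rfl | hy) hxy
    · exact absurd (nil_le x) hxy.lt.not_ge
    · rw [hψ y (hsub hy), hψ x (hxy.par.mem_relAncTuple hy)]
      exact hφ.jump (hsub hy) hxy
  · rintro x y (rfl | hy) hxy
    · exact absurd (nil_le x) hxy.lt.not_ge
    · rw [hψ y (hsub hy), hψ x (hxy.par.mem_relAncTuple hy)]
      exact hφ.plus (hsub hy) hxy
  · rintro y (rfl | hy)
    · rw [hnil]
      exact ⟨rfl, rfl⟩
    · rw [hψ y (hsub hy)]
      exact hφ.label (hsub hy)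
  · rw [hψ _ (mem_relAncTuple.2 ⟨i, self_mem_relAnc _ _⟩), h0]
  · have key : ∀ x ∈ relAncTuple (l + 1) ρs, ψ x = nil N → x = nil N := by
      intro x hx hx'
      by_contra hne
      obtain ⟨δ, z, hz⟩ := exists_edge hne
      have := hφ.edge hx hz
      rw [← hψ x hx, hx'] at this
      exact not_edge_nil this
    rintro x (rfl | hx) y (rfl | hy) hxy
    · rfl
    · exact (key y hy (by rw [← hxy, hnil])).symm
    · exact key x hx (by rw [hxy, hnil])
    · rw [hψ x hx, hψ y hy] at hxy
      exact hinj (hsub' hx) (hsub' hy) hxy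

theorem IsLocal.mem_relAncNil {l k n : ℕ} {ρs ρs' : Fin n → NPT N} {φ : NPT N → NPT N}
    (h : IsLocal (relAncNil l ρs) φ) (h₀ : ∀ i, φ (ρs i) = ρs' i) (hk : k ≤ l + 1) {x : NPT N}
    (hx : x ∈ relAncNil k ρs) : φ x ∈ relAncNil k ρs' := by
  rcases hx with rfl | hx
  · exact Or.inl (h.nil (nil_mem_relAncNil _ _))
  · obtain ⟨i, hi⟩ := mem_relAncTuple.1 hx
    refine Or.inr (mem_relAncTuple.2 ⟨i, ?_⟩)
    rw [← h₀]
    exact h.mem_relAnc (fun z hz => Or.inr (mem_relAncTuple.2 ⟨i, hz⟩)) hk hi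

theorem IsLocal.exists_of_mem_relAncNil {l k n : ℕ} {ρs ρs' : Fin n → NPT N}
    {φ : NPT N → NPT N} (h : IsLocal (relAncNil l ρs) φ) (h₀ : ∀ i, φ (ρs i) = ρs' i)
    (hk : k ≤ l + 1) {x' : NPT N} (hx : x' ∈ relAncNil k ρs') : ∃ x ∈ relAncNil k ρs, φ x = x' := by
  rcases hx with rfl | hx
  · exact ⟨_, nil_mem_relAncNil _ _, h.nil (nil_mem_relAncNil _ _)⟩
  · obtain ⟨i, hi⟩ := mem_relAncTuple.1 hx
    rw [← h₀] at hi
    obtain ⟨x, h1, h2⟩ :=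
      h.exists_of_mem_relAnc (fun z hz => Or.inr (mem_relAncTuple.2 ⟨i, hz⟩)) hk hi
    exact ⟨x, Or.inr (mem_relAncTuple.2 ⟨i, h1⟩), h2⟩

/-! ### Short copies of a single edge -/

theorem length_eq_of_word {x : NPT N} {w u : List (Transition Q Γ)} (h : word x = w ++ u) :
    x.1.length = w.length + u.length := by
  rw [← length_word, h, List.length_append]

/-- Let `P` and `P'` be the sets of nodes that are reached from two nodes by the runs of a given
type. If `P'` has no more elements in `B'` than `P` has in `B`, and `P` is not contained in `B`, then
there is a short element of `P'` outside of `B'`. -/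
theorem exists_short_notMem [Finite Q] [Finite Γ] {t : RunType Q Γ} {w w' : List (Transition Q Γ)}
    {P P' : NPT N → Prop} {B B' : Set (NPT N)} {φ : NPT N → NPT N} {π : NPT N} {K : ℕ}
    (hP : ∀ y, P y → ∃ u, word y = w ++ u ∧ RunType.Lang N t u)
    (hP₁ : ∀ u, RunType.Lang N t u → ∃ y, word y = w' ++ u ∧ P' y)
    (hB : B'.Finite) (hK : B'.ncard ≤ K) (hφ : ∀ y' ∈ B', P' y' → ∃ y ∈ B, P y ∧ φ y = y')
    (hπ : P π) (hπB : π ∉ B) : ∃ π', P' π' ∧ π' ∉ B' ∧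
      π'.1.length ≤ w'.length + (K + 1) * 2 ^ (2 + Nat.card (RunType Q Γ)) := by
  set bad : Set (List (Transition Q Γ)) := {u | RunType.Lang N t u ∧ ∃ y ∈ B', word y = w' ++ u}
  have hsub : bad ⊆ (fun y => (word y).drop w'.length) '' B' := by
    rintro u ⟨_, y, hy, hyu⟩
    exact ⟨y, hy, by simp [hyu]⟩
  have hfin : bad.Finite := (hB.image _).subset hsub
  have hcard : bad.ncard ≤ K :=
    ((Set.ncard_le_ncard hsub (hB.image _)).trans (Set.ncard_image_le hB)).trans hK
  -- If all words of the type were bad, there would be finitely many. Sending `v` to the word of a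
  -- `φ`-preimage of the node `w' ++ v` is then an injective self-map, hence surjective. So the word
  -- leading to `π` is attained, and `π` lies in `B`.
  obtain ⟨u, hu, hu'⟩ : ∃ u, RunType.Lang N t u ∧ u ∉ bad := by
    by_contra! hall
    have hall' : ∀ v : {u // RunType.Lang N t u}, ∃ v' : {u // RunType.Lang N t u},
        ∃ y ∈ B, word y = w ++ v'.1 ∧ word (φ y) = w' ++ v.1 := by
      rintro ⟨v, hv⟩
      obtain ⟨_, y', hy', hyv⟩ := hall v hv
      obtain ⟨z, hz, hz'⟩ := hP₁ v hv
      obtain rfl : y' = z := word_injective (hyv.trans hz.symm)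
      obtain ⟨y, hy, h1, rfl⟩ := hφ y' hy' hz'
      obtain ⟨v', h2, h3⟩ := hP y h1
      exact ⟨⟨v', h3⟩, y, hy, h2, hyv⟩
    choose g y hy hg hg' using hall'
    have : Finite {u // RunType.Lang N t u} := (hfin.subset fun u hu => hall u hu).to_subtype
    have hinj : Function.Injective g := by
      intro v₁ v₂ h
      have h1 : y v₁ = y v₂ := word_injective (by rw [hg, hg, h])
      have h2 := hg' v₁
      rw [h1, hg' v₂] at h2
      exact (Subtype.ext (List.append_cancel_left h2)).symm
    obtain ⟨v, h1, h2⟩ := hP π hπ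
    obtain ⟨v₀, hv₀⟩ := Finite.injective_iff_surjective.1 hinj ⟨v, h2⟩
    have h3 := hg v₀
    rw [hv₀] at h3
    have h4 : π = y v₀ := word_injective (h1.trans h3.symm)
    exact hπB (h4 ▸ hy v₀)
  obtain ⟨v, h1, h2, h3⟩ := hu.exists_short_notMem hfin hu'
  obtain ⟨π', h4, h5⟩ := hP₁ v h1
  refine ⟨π', h5, fun h6 => h2 ⟨h1, π', h6, h4⟩, ?_⟩
  rw [length_eq_of_word h4]
  exact Nat.add_le_add_left (h3.trans (Nat.mul_le_mul_right _ (by omega))) _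

/-- A partial copy `ψ` with domain `U` of the relevant ancestors of a node: it agrees with `φ` on the
nodes in `G`, and every node outside of `G` lies above one whose copy avoids `B`. -/
structure IsCopy (G : Set (NPT N)) (φ : NPT N → NPT N) (B : Set (NPT N)) (M : NPT N → ℕ)
    (U : Set (NPT N)) (ψ : NPT N → NPT N) : Prop where
  label : ∀ x ∈ U, st (ψ x) = st x ∧ tp (ψ x) = tp x
  lt : ∀ x ∈ U, ∀ y ∈ U, x < y → ψ x < ψ y
  plus : ∀ x ∈ U, ∀ y ∈ U, PlusEdge x y → PlusEdge (ψ x) (ψ y)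
  edge : ∀ δ, ∀ x ∈ U, ∀ y ∈ U, Edge δ x y → Edge δ (ψ x) (ψ y)
  agree : ∀ x ∈ U, x ∈ G → ψ x = φ x
  fresh : ∀ x ∈ U, x ∉ G → ∃ b ∈ U, b ≤ x ∧ ψ b ∉ B
  length : ∀ x ∈ U, x ∉ G → (ψ x).1.length ≤ M x

namespace IsCopy

variable {G B U : Set (NPT N)} {φ ψ : NPT N → NPT N} {M : NPT N → ℕ}

-- If `U` already contains a node with copy outside `B`, the new node inherits its freshness; only
-- the first new node has to avoid `B` itself.
open Classical in
theorem insert_top (h : IsCopy G φ B M U ψ) {π π' : NPT N} (hU : ∀ x ∈ U, x < π)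
    (hlabel : st π' = st π ∧ tp π' = tp π) (hlt : ∀ x ∈ U, ψ x < π')
    (hplus : ∀ x ∈ U, PlusEdge x π → PlusEdge (ψ x) π')
    (hedge : ∀ δ, ∀ x ∈ U, Edge δ x π → Edge δ (ψ x) π')
    (hagree : π ∈ G → π' = φ π) (hfresh : π ∉ G → (∃ b ∈ U, ψ b ∉ B) ∨ π' ∉ B)
    (hlength : π ∉ G → π'.1.length ≤ M π) :
    IsCopy G φ B M (insert π U) (Function.update ψ π π') := by
  have hπ : Function.update ψ π π' π = π' := Function.update_self ..
  have hne : ∀ x ∈ U, Function.update ψ π π' x = ψ x := fun x hx =>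
    Function.update_of_ne (hU x hx).ne _ _
  refine ⟨?_, ?_, ?_, ?_, ?_, ?_, ?_⟩
  · rintro x (rfl | hx)
    · rwa [hπ]
    · rw [hne x hx]; exact h.label x hx
  · rintro x (rfl | hx) y (rfl | hy) hxy
    · exact absurd hxy (lt_irrefl _)
    · exact absurd (hxy.trans (hU y hy)) (lt_irrefl _)
    · rw [hπ, hne x hx]; exact hlt x hx
    · rw [hne x hx, hne y hy]; exact h.lt x hx y hy hxy
  · rintro x (rfl | hx) y (rfl | hy) hxy
    · exact absurd hxy.lt (lt_irrefl _)
    · exact absurd (hxy.lt.trans (hU y hy)) (lt_irrefl _)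
    · rw [hπ, hne x hx]; exact hplus x hx hxy
    · rw [hne x hx, hne y hy]; exact h.plus x hx y hy hxy
  · rintro δ x (rfl | hx) y (rfl | hy) hxy
    · exact absurd hxy.lt (lt_irrefl _)
    · exact absurd (hxy.lt.trans (hU y hy)) (lt_irrefl _)
    · rw [hπ, hne x hx]; exact hedge δ x hx hxy
    · rw [hne x hx, hne y hy]; exact h.edge δ x hx y hy hxy
  · rintro x (rfl | hx) hG
    · rw [hπ]; exact hagree hG
    · rw [hne x hx]; exact h.agree x hx hG
  · rintro x (rfl | hx) hG
    · rcases hfresh hG with ⟨b, hb, hb'⟩ | hx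
      · exact ⟨b, Or.inr hb, (hU b hb).le, by rwa [hne b hb]⟩
      · exact ⟨x, Or.inl rfl, le_rfl, by rwa [hπ]⟩
    · obtain ⟨b, hb, h1, h2⟩ := h.fresh x hx hG
      exact ⟨b, Or.inr hb, h1, by rwa [hne b hb]⟩
  · rintro x (rfl | hx) hG
    · rw [hπ]; exact hlength hG
    · rw [hne x hx]; exact h.length x hx hG

end IsCopy

/-- A copy of an edge that starts at a node with the same label; if it pops a letter, the letter
below must be the same. -/
theorem exists_edge_of_label_eq {p π p' : NPT N} {δ : Transition Q Γ} (h : Edge δ p π)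
    (hl : st p' = st p ∧ tp p' = tp p)
    (hg : δ.op = .pop → ∃ g g', PlusEdge g p ∧ PlusEdge g' p' ∧ tp g' = tp g) :
    ∃ π', Edge δ p' π' ∧ st π' = st π ∧ tp π' = tp π := by
  obtain ⟨s', hs'⟩ := exists_last_eq p'
  rw [hl.1, hl.2] at hs'
  obtain ⟨hδ, ⟨b, s, h1, h2, h3⟩ | ⟨b, s, h1, h2, h3⟩⟩ := step_iff.1 h.step
  · rw [(st_tp_of_last h2).1, (st_tp_of_last h2).2] at hs'
    have h4 := step_push hδ h1 s'
    rw [← hs'] at h4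
    obtain ⟨π', h5, h6⟩ := exists_append (.single h4)
    refine ⟨π', edge_iff.2 h5, ?_, ?_⟩
    · rw [(st_tp_of_last h3).1, (st_tp_of_last h6).1]
    · rw [(st_tp_of_last h3).2, (st_tp_of_last h6).2]
  · rw [(st_tp_of_last h2).1, (st_tp_of_last h2).2] at hs'
    obtain ⟨g, g', hg, hg', hgg⟩ := hg h1
    cases s' with
    | nil =>
      have h4 := two_le_wd_of_lt (hg'.wd_lt hg'.lt le_rfl)
      simp [wd, hs'] at h4
    | cons b' s' =>
      have h4 := step_pop hδ h1 b' s'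
      rw [← hs'] at h4
      obtain ⟨π', h5, h6⟩ := exists_append (.single h4)
      have h7 : Edge δ p' π' := edge_iff.2 h5
      refine ⟨π', h7, ?_, ?_⟩
      · rw [(st_tp_of_last h3).1, (st_tp_of_last h6).1]
      · rw [(h7.jump h1 hg').tp_eq, (h.jump h1 hg).tp_eq, hgg]

/-- The conditions on `π'` to be a copy of `π` next to a copy `p'` of the neighbour `p` of `π`. -/
def SameEdge (p π p' π' : NPT N) : Prop :=
  (∃ δ, Edge δ p π ∧ Edge δ p' π') ∨
    (∀ δ, ¬Edge δ p π) ∧ (Jump p π ∧ Jump p' π' ∨ PlusEdge p π ∧ PlusEdge p' π')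

theorem SameEdge.lt {p π p' π' : NPT N} (h : SameEdge p π p' π') : p' < π' := by
  rcases h with ⟨δ, _, h⟩ | ⟨_, ⟨_, h⟩ | ⟨_, h⟩⟩ <;> exact h.lt

/-- Nodes without relevant ancestors can be copied by short nodes. -/
theorem exists_short_start [Finite Q] [Finite Γ] {B B' : Set (NPT N)} {φ : NPT N → NPT N}
    {π : NPT N} {K : ℕ} (hB : B'.Finite) (hK : B'.ncard ≤ K)
    (hφ : ∀ y' ∈ B', ∃ y ∈ B, (st (φ y) = st y ∧ tp (φ y) = tp y) ∧ φ y = y') (hπ : π ∉ B) :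
    ∃ π', (st π' = st π ∧ tp π' = tp π) ∧ π' ∉ B' ∧
      π'.1.length ≤ (K + 1) * 2 ^ (2 + Nat.card (RunType Q Γ)) := by
  have := exists_short_notMem (t := .reach N.init N.bot (st π) (tp π)) (w := []) (w' := [])
    (P := fun y => st y = st π ∧ tp y = tp π) (P' := fun y => st y = st π ∧ tp y = tp π)
    (φ := φ) (π := π) (B := B) (fun y hy => ⟨word y, rfl, by
      rw [← hy.1, ← hy.2]
      exact reach_lang y⟩) (fun u hu => exists_of_reach_lang hu) hB hK (fun y' hy' hl => by
      obtain ⟨y, h1, h2, rfl⟩ := hφ y' hy'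
      exact ⟨y, h1, ⟨h2.1.symm.trans hl.1, h2.2.symm.trans hl.2⟩, rfl⟩) ⟨rfl, rfl⟩ hπ
  simpa using this

/-- Nodes connected to a copied neighbour `p` can be copied without getting much longer; the copy can
be chosen outside of a finite set `B'` if `B'` corresponds to a set `B` which does not contain the
node. -/
theorem exists_short_sameEdge [Finite Q] [Finite Γ] {B B' : Set (NPT N)} {φ : NPT N → NPT N}
    {p π p' : NPT N} {K : ℕ} (hB : B'.Finite) (hK : B'.ncard ≤ K)
    (hφ : ∀ y' ∈ B', ∃ y ∈ B, (st (φ y) = st y ∧ tp (φ y) = tp y) ∧ φ y = y' ∧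
      (∀ δ, Edge δ p' y' → Edge δ p y) ∧ (Jump p' y' → Jump p y) ∧ (PlusEdge p' y' → PlusEdge p y))
    (hπ : π ∉ B) (hp : Par p π) (hl : st p' = st p ∧ tp p' = tp p)
    (hg : ∀ δ, Edge δ p π → δ.op = .pop →
      ∃ g g', PlusEdge g p ∧ PlusEdge g' p' ∧ tp g' = tp g) :
    ∃ π', SameEdge p π p' π' ∧ (st π' = st π ∧ tp π' = tp π) ∧ π' ∉ B' ∧
      π'.1.length ≤ p'.1.length + (K + 1) * 2 ^ (2 + Nat.card (RunType Q Γ)) := by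
  by_cases hE : ∃ δ, Edge δ p π
  · obtain ⟨δ, hE⟩ := hE
    obtain ⟨π', h1, h2⟩ := exists_edge_of_label_eq hE hl (hg δ hE)
    refine ⟨π', Or.inl ⟨δ, hE, h1⟩, h2, fun h3 => ?_, ?_⟩
    -- The copy along a transition is forced. If it were in `B'`, its preimage in `B` would be the
    -- `δ`-successor of `p`, which is `π`.
    · obtain ⟨y, hy, _, _, h4, _⟩ := hφ π' h3
      exact hπ (hE.unique_right (h4 δ h1) ▸ hy)
    · rw [length_eq_of_word (edge_iff.1 h1), length_word]
      exact Nat.add_le_add_left (Nat.mul_pos (Nat.succ_pos _) (Nat.two_pow_pos _)) _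
  · push Not at hE
    rcases hp with ⟨δ, _, hp⟩ | hp | hp
    · exact absurd hp (hE δ)
    · obtain ⟨π', h1, h2, h3⟩ := exists_short_notMem (t := .jump (st p) (tp p) (st π))
        (w := word p) (w' := word p') (P := fun y => Jump p y ∧ st y = st π)
        (P' := fun y => Jump p' y ∧ st y = st π) (φ := φ) (π := π) (B := B) (fun y hy => by
          rw [← hy.2]
          exact hy.1.lang) (fun u hu => by
          rw [← hl.1, ← hl.2] at hu
          obtain ⟨y, h1, h2, h3, _⟩ := exists_jump_of_lang hu
          exact ⟨y, h1, h2, h3⟩) hB hK (fun y' hy' hJ => by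
          obtain ⟨y, h1, h2, rfl, _, h3, _⟩ := hφ y' hy'
          exact ⟨y, h1, ⟨h3 hJ.1, h2.1.symm.trans hJ.2⟩, rfl⟩) ⟨hp, rfl⟩ hπ
      rw [length_word] at h3
      exact ⟨π', Or.inr ⟨hE, Or.inl ⟨hp, h1.1⟩⟩,
        ⟨h1.2, by rw [h1.1.tp_eq, hp.tp_eq, hl.2]⟩, h2, h3⟩
    · obtain ⟨π', h1, h2, h3⟩ := exists_short_notMem (t := .plus (st p) (tp p) (st π) (tp π))
        (w := word p) (w' := word p') (P := fun y => PlusEdge p y ∧ st y = st π ∧ tp y = tp π)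
        (P' := fun y => PlusEdge p' y ∧ st y = st π ∧ tp y = tp π) (φ := φ) (π := π) (B := B)
        (fun y hy => by
          rw [← hy.2.1, ← hy.2.2]
          exact hy.1.lang) (fun u hu => by
          rw [← hl.1, ← hl.2] at hu
          exact exists_plusEdge_of_lang hu) hB hK (fun y' hy' hJ => by
          obtain ⟨y, h1, h2, rfl, _, _, h3⟩ := hφ y' hy'
          exact ⟨y, h1, ⟨h3 hJ.1, h2.1.symm.trans hJ.2.1, h2.2.symm.trans hJ.2.2⟩, rfl⟩)
        ⟨hp, rfl, rfl⟩ hπ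
      rw [length_word] at h3
      exact ⟨π', Or.inr ⟨hE, Or.inr ⟨hp, h1.1⟩⟩, h1.2, h2, h3⟩

/-! ### Copying the chain of relevant ancestors -/

section Copy

variable {n T l C : ℕ} {ρs ρs' : Fin n → NPT N} {φ : NPT N → NPT N} {ρ : NPT N}

theorem IsLocal.exists_edges_iff (hφ : IsLocal (relAncNil T ρs) φ) (h₀ : ∀ i, φ (ρs i) = ρs' i)
    (hinj : Set.InjOn φ (relAncNil (T + 1) ρs)) {y' : NPT N} (hy' : y' ∈ relAncNil T ρs') :
    ∃ y ∈ relAncNil T ρs, (st (φ y) = st y ∧ tp (φ y) = tp y) ∧ φ y = y' ∧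
      ∀ p ∈ relAncNil T ρs, (∀ δ, Edge δ (φ p) y' → Edge δ p y) ∧
        (Jump (φ p) y' → Jump p y) ∧ (PlusEdge (φ p) y' → PlusEdge p y) := by
  obtain ⟨y, hy, rfl⟩ := hφ.exists_of_mem_relAncNil h₀ (Nat.le_succ T) hy'
  have hsub := relAncNil_mono (Nat.le_succ T) ρs
  refine ⟨y, hy, hφ.label hy, rfl, fun p hp => ⟨fun δ h => ?_, fun h => ?_, fun h => ?_⟩⟩
  · obtain ⟨x, h1, h2⟩ := hφ.exists_edge_of_edge hy h
    rwa [← hinj (h1.par.mem_relAncNil hy) (hsub hp) h2]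
  · obtain ⟨x, h1, h2⟩ := hφ.exists_jump_of_jump hy h
    rwa [← hinj (h1.par.mem_relAncNil hy) (hsub hp) h2]
  · obtain ⟨x, h1, h2⟩ := hφ.exists_plusEdge_of_plusEdge hy h
    rwa [← hinj (h1.par.mem_relAncNil hy) (hsub hp) h2]

/-- The relevant ancestors of `ρ` all of whose predecessors among the relevant ancestors are
relevant ancestors of the tuple `ρs`. -/
def oldAnc (T l : ℕ) {n : ℕ} (ρs : Fin n → NPT N) (ρ : NPT N) : Set (NPT N) :=
  {x | ∀ z ∈ relAnc l ρ, z ≤ x → z ∈ relAncNil T ρs}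

/-- The bound on the lengths of runs in the construction of a copy. -/
noncomputable def copyBound (C T l n : ℕ) (ρ x : NPT N) : ℕ :=
  C + (n * 4 ^ T + 2) * 2 ^ (2 + Nat.card (RunType Q Γ)) +
    {z | z ∈ relAnc l ρ ∧ z ≤ x}.ncard * 2 ^ (2 + Nat.card (RunType Q Γ))

theorem finite_relAnc_le (l : ℕ) (ρ x : NPT N) : {z | z ∈ relAnc l ρ ∧ z ≤ x}.Finite := by
  obtain ⟨F, _, hF⟩ := exists_finset_relAnc l ρ
  refine F.finite_toSet.subset fun z hz => ?_
  rw [← hF]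
  exact hz.1

/-- Moving up the chain adds at least one node to the count, which pays for one unrestricted copy of
an edge. -/
theorem copyBound_add_le {p π : NPT N} (hπ : π ∈ relAnc l ρ) (hpπ : p < π) :
    copyBound C T l n ρ p + 2 ^ (2 + Nat.card (RunType Q Γ)) ≤ copyBound C T l n ρ π := by
  have h : {z | z ∈ relAnc l ρ ∧ z ≤ p}.ncard < {z | z ∈ relAnc l ρ ∧ z ≤ π}.ncard := by
    refine Set.ncard_lt_ncard ⟨fun z hz => ⟨hz.1, hz.2.trans hpπ.le⟩, fun h => ?_⟩
      (finite_relAnc_le l ρ π)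
    exact absurd (h ⟨hπ, le_rfl⟩).2 hpπ.not_ge
  have := Nat.mul_le_mul_right (2 ^ (2 + Nat.card (RunType Q Γ))) h
  rw [Nat.succ_eq_add_one, add_mul, one_mul] at this
  unfold copyBound
  omega

theorem copyBound_le {x : NPT N} : copyBound C T l n ρ x ≤
    C + (n * 4 ^ T + 2 + 4 ^ l) * 2 ^ (2 + Nat.card (RunType Q Γ)) := by
  obtain ⟨F, hF, hF'⟩ := exists_finset_relAnc l ρ
  have h : {z | z ∈ relAnc l ρ ∧ z ≤ x}.ncard ≤ 4 ^ l := by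
    refine le_trans ?_ hF
    rw [← Set.ncard_coe_finset, ← hF']
    exact Set.ncard_le_ncard (fun z hz => hz.1) (hF' ▸ F.finite_toSet)
  have := Nat.mul_le_mul_right (2 ^ (2 + Nat.card (RunType Q Γ))) h
  unfold copyBound
  rw [add_mul _ (4 ^ l)]
  omega

variable [Finite Q] [Finite Γ]

/-- The extension of a copy by one node. -/
theorem IsCopy.exists_extension (hφ : IsLocal (relAncNil T ρs) φ) (h₀ : ∀ i, φ (ρs i) = ρs' i)
    (hinj : Set.InjOn φ (relAncNil (T + 1) ρs)) (hC : ∀ y ∈ relAncNil T ρs', y.1.length ≤ C)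
    {p π : NPT N} (hp : p ∈ relAnc l ρ) (hπ : π ∈ relAnc l ρ) (hpπ : p < π)
    (hcons : ∀ z ∈ relAnc l ρ, z < π → z ≤ p) {ψ : NPT N → NPT N}
    (h : IsCopy (oldAnc T l ρs ρ) φ (relAncNil T ρs') (copyBound C T l n ρ)
      {x | x ∈ relAnc l ρ ∧ x ≤ p} ψ) :
    ∃ ψ', IsCopy (oldAnc T l ρs ρ) φ (relAncNil T ρs') (copyBound C T l n ρ)
      {x | x ∈ relAnc l ρ ∧ x ≤ π} ψ' := by
  have hU : {x | x ∈ relAnc l ρ ∧ x ≤ π} = insert π {x | x ∈ relAnc l ρ ∧ x ≤ p} := by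
    ext x
    constructor
    · rintro ⟨hx, hxπ⟩
      rcases hxπ.eq_or_lt with rfl | hxπ
      · exact Or.inl rfl
      · exact Or.inr ⟨hx, hcons x hx hxπ⟩
    · rintro (rfl | hx)
      · exact ⟨hπ, le_rfl⟩
      · exact ⟨hx.1, hx.2.trans hpπ.le⟩
  have hpU : p ∈ {x | x ∈ relAnc l ρ ∧ x ≤ p} := ⟨hp, le_rfl⟩
  have hltU : ∀ x ∈ {x | x ∈ relAnc l ρ ∧ x ≤ p}, x < π := fun x hx => hx.2.trans_lt hpπ
  have hle : ∀ x ∈ {x | x ∈ relAnc l ρ ∧ x ≤ p}, ψ x ≤ ψ p := fun x hx => by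
    rcases hx.2.eq_or_lt with rfl | h1
    · exact le_rfl
    · exact (h.lt x hx p hpU h1).le
  have hGle : ∀ x ∈ {x | x ∈ relAnc l ρ ∧ x ≤ p}, π ∈ oldAnc T l ρs ρ → x ∈ oldAnc T l ρs ρ :=
    fun x hx hG z hz hzx => hG z hz (hzx.trans (hltU x hx).le)
  obtain ⟨hpar, hjump⟩ := par_of_consecutive hp hπ hpπ hcons
  rw [hU]
  by_cases hG : π ∈ oldAnc T l ρs ρ
  · have hπT : π ∈ relAncNil T ρs := hG π hπ le_rfl
    have hagree : ∀ x ∈ {x | x ∈ relAnc l ρ ∧ x ≤ p}, ψ x = φ x :=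
      fun x hx => h.agree x hx (hGle x hx hG)
    refine ⟨_, h.insert_top (π' := φ π) hltU (hφ.label hπT) (fun x hx => ?_) (fun x hx hxπ => ?_)
      (fun δ x hx hxπ => ?_) (fun _ => rfl) (fun h => absurd hG h) (fun h => absurd hG h)⟩
    · refine (hle x hx).trans_lt ?_
      rw [hagree p hpU]
      exact (hφ.par hπT hpar).lt
    · rw [hagree x hx]
      exact hφ.plus hπT hxπ
    · rw [hagree x hx]
      exact hφ.edge hπT hxπ
  · have hg : ∀ δ, Edge δ p π → δ.op = .pop → ∃ g ∈ {x | x ∈ relAnc l ρ ∧ x ≤ p},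
        Jump g π ∧ PlusEdge g p ∧ PlusEdge (ψ g) (ψ p) ∧ tp (ψ g) = tp g := by
      intro δ hE hop
      obtain ⟨g, hg⟩ := exists_jump hE hop
      have h1 := (hE.exists_jump hg).2
      have h2 : g ∈ {x | x ∈ relAnc l ρ ∧ x ≤ p} := ⟨hjump δ g hop hE hg, h1.lt.le⟩
      exact ⟨g, h2, hg, h1, h.plus g h2 p hpU h1, (h.label g h2).2⟩
    obtain ⟨π', hsame, hlabel, hfresh, hlength⟩ : ∃ π', SameEdge p π (ψ p) π' ∧
        (st π' = st π ∧ tp π' = tp π) ∧ (p ∈ oldAnc T l ρs ρ → π' ∉ relAncNil T ρs') ∧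
        π'.1.length ≤ copyBound C T l n ρ π := by
      have hg' : ∀ δ, Edge δ p π → δ.op = .pop →
          ∃ g g', PlusEdge g p ∧ PlusEdge g' (ψ p) ∧ tp g' = tp g := fun δ hE hop => by
        obtain ⟨g, _, _, h1, h2, h3⟩ := hg δ hE hop
        exact ⟨g, ψ g, h1, h2, h3⟩
      by_cases hpG : p ∈ oldAnc T l ρs ρ
      · have hpT : p ∈ relAncNil T ρs := hpG p hp le_rfl
        have hψp := h.agree p hpU hpG
        -- Everything up to `p` is old, so `π` fails to be old only because it is itself no relevant
        -- ancestor of the tuple.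
        have hπT : π ∉ relAncNil T ρs := fun hπT => hG fun z hz hzπ => by
          rcases hzπ.eq_or_lt with rfl | hzπ
          · exact hπT
          · exact hpG z hz (hcons z hz hzπ)
        obtain ⟨F, hF, hF'⟩ := exists_finset_relAncNil T ρs'
        obtain ⟨π', h1, h2, h3, h4⟩ := exists_short_sameEdge (B := relAncNil T ρs)
          (B' := relAncNil T ρs') (φ := φ) (p := p) (p' := ψ p) (π := π) (K := n * 4 ^ T + 1)
          (hF' ▸ F.finite_toSet) (by rw [hF', Set.ncard_coe_finset]; exact hF) (fun y' hy' => by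
            obtain ⟨y, h1, h2, h3, h4⟩ := hφ.exists_edges_iff h₀ hinj hy'
            rw [hψp]
            exact ⟨y, h1, h2, h3, h4 p hpT⟩) hπT hpar (h.label p hpU) hg'
        refine ⟨π', h1, h2, fun _ => h3, h4.trans ?_⟩
        have h5 := hC _ (hφ.mem_relAncNil h₀ (Nat.le_succ T) hpT)
        rw [hψp, show n * 4 ^ T + 1 + 1 = n * 4 ^ T + 2 from rfl]
        unfold copyBound
        omega
      -- The chain has already left the old nodes, so nothing has to be avoided any more.
      · obtain ⟨π', h1, h2, h3, h4⟩ := exists_short_sameEdge (B := ∅)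
          (B' := ∅) (φ := φ) (p := p) (p' := ψ p) (π := π) (K := 0)
          Set.finite_empty (by simp) (fun y' hy' => hy'.elim) (Set.notMem_empty π) hpar
          (h.label p hpU) hg'
        refine ⟨π', h1, h2, fun h => absurd h hpG, h4.trans ?_⟩
        have h5 := h.length p hpU hpG
        have h6 : copyBound C T l n ρ p + _ ≤ _ := copyBound_add_le hπ hpπ
        omega
    refine ⟨_, h.insert_top hltU hlabel (fun x hx => (hle x hx).trans_lt hsame.lt)
      (fun x hx hxπ => ?_) (fun δ x hx hxπ => ?_) (fun h => absurd h hG) (fun _ => ?_)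
      (fun _ => hlength)⟩
    -- The `+1`-predecessor of `π` is `p` for a push or a `+1`-edge, that of `p` for a jump, and
    -- that of the jump source `g` for a pop.
    · rcases hsame with ⟨δ, h1, h2⟩ | ⟨_, ⟨h1, h2⟩ | ⟨h1, h2⟩⟩
      · cases hop : δ.op with
        | push b =>
          rw [hxπ.unique (h1.plusEdge hop)]
          exact h2.plusEdge hop
        | pop =>
          obtain ⟨g, hgU, h3, _, h4, _⟩ := hg δ h1 hop
          exact (h2.jump hop h4).plusEdge_iff.2 (h.plus x hx g hgU (h3.plusEdge_iff.1 hxπ))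
      · exact h2.plusEdge_iff.2 (h.plus x hx p hpU (h1.plusEdge_iff.1 hxπ))
      · rwa [hxπ.unique h1]
    · obtain rfl : x = p := le_antisymm hx.2 (hxπ.le_of_lt hpπ)
      rcases hsame with ⟨ε, h1, h2⟩ | ⟨h1, _⟩
      · rwa [(hxπ.unique h1).2]
      · exact absurd hxπ (h1 δ)
    · by_cases hpG : p ∈ oldAnc T l ρs ρ
      · exact Or.inr (hfresh hpG)
      · obtain ⟨b, h1, _, h2⟩ := h.fresh p hpU hpG
        exact Or.inl ⟨b, h1, h2⟩

/-- The copy of a node without relevant ancestors below it. -/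
theorem exists_isCopy_of_minimal (hφ : IsLocal (relAncNil T ρs) φ) (h₀ : ∀ i, φ (ρs i) = ρs' i)
    (hinj : Set.InjOn φ (relAncNil (T + 1) ρs))
    {π : NPT N} (hπ : π ∈ relAnc l ρ) (hmin : ∀ z ∈ relAnc l ρ, ¬z < π) :
    ∃ ψ', IsCopy (oldAnc T l ρs ρ) φ (relAncNil T ρs') (copyBound C T l n ρ)
      {x | x ∈ relAnc l ρ ∧ x ≤ π} ψ' := by
  have hU : {x | x ∈ relAnc l ρ ∧ x ≤ π} = insert π ∅ := by
    ext x
    constructor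
    · rintro ⟨hx, hxπ⟩
      exact Or.inl (hxπ.eq_of_not_lt (hmin x hx))
    · rintro (rfl | hx)
      · exact ⟨hπ, le_rfl⟩
      · exact hx.elim
  have hG : π ∈ oldAnc T l ρs ρ ↔ π ∈ relAncNil T ρs := by
    refine ⟨fun h => h π hπ le_rfl, fun h z hz hzπ => ?_⟩
    rwa [hzπ.eq_of_not_lt (hmin z hz)]
  have h : IsCopy (oldAnc T l ρs ρ) φ (relAncNil T ρs') (copyBound C T l n ρ) ∅ φ := by
    constructor <;> simp
  rw [hU]
  by_cases hT : π ∈ relAncNil T ρs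
  · exact ⟨_, h.insert_top (π' := φ π) (by simp) (hφ.label hT) (by simp) (by simp) (by simp)
      (fun _ => rfl) (fun h => absurd (hG.2 hT) h) (fun h => absurd (hG.2 hT) h)⟩
  · obtain ⟨F, hF, hF'⟩ := exists_finset_relAncNil T ρs'
    obtain ⟨π', h1, h2, h3⟩ := exists_short_start (B := relAncNil T ρs)
      (B' := relAncNil T ρs') (φ := φ) (π := π) (K := n * 4 ^ T + 1)
      (hF' ▸ F.finite_toSet) (by rw [hF', Set.ncard_coe_finset]; exact hF) (fun y' hy' => by
        obtain ⟨y, h1, h2, h3, h4⟩ := hφ.exists_edges_iff h₀ hinj hy'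
        exact ⟨y, h1, h2, h3⟩) hT
    refine ⟨_, h.insert_top (by simp) h1 (by simp) (by simp) (by simp)
      (fun h => absurd (hG.1 h) hT) (fun _ => Or.inr h2) (fun _ => h3.trans ?_)⟩
    rw [show n * 4 ^ T + 1 + 1 = n * 4 ^ T + 2 from rfl]
    unfold copyBound
    omega

theorem exists_isCopy (hφ : IsLocal (relAncNil T ρs) φ) (h₀ : ∀ i, φ (ρs i) = ρs' i)
    (hinj : Set.InjOn φ (relAncNil (T + 1) ρs)) (hC : ∀ y ∈ relAncNil T ρs', y.1.length ≤ C)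
    (l : ℕ) (ρ : NPT N) :
    ∃ ψ', IsCopy (oldAnc T l ρs ρ) φ (relAncNil T ρs') (copyBound C T l n ρ) (relAnc l ρ) ψ' := by
  suffices ∀ π ∈ relAnc l ρ, ∃ ψ', IsCopy (oldAnc T l ρs ρ) φ (relAncNil T ρs')
      (copyBound C T l n ρ) {x | x ∈ relAnc l ρ ∧ x ≤ π} ψ' by
    have h1 : {x | x ∈ relAnc l ρ ∧ x ≤ ρ} = relAnc l ρ :=
      Set.ext fun x => ⟨fun h => h.1, fun h => ⟨h, le_of_mem_relAnc h⟩⟩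
    have h2 := this ρ (self_mem_relAnc l ρ)
    rwa [h1] at h2
  intro π hπ
  induction hn : π.1.length using Nat.strong_induction_on generalizing π with
  | _ k ih =>
  subst hn
  by_cases hmin : ∀ z ∈ relAnc l ρ, ¬z < π
  · exact exists_isCopy_of_minimal hφ h₀ hinj hπ hmin
  · push Not at hmin
    obtain ⟨z, hz, hzπ⟩ := hmin
    have hfin : {x | x ∈ relAnc l ρ ∧ x < π}.Finite :=
      (finite_relAnc_le l ρ π).subset fun x hx => ⟨hx.1, hx.2.le⟩
    obtain ⟨p, hp⟩ := hfin.exists_maximal ⟨z, hz, hzπ⟩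
    obtain ⟨ψ, hψ⟩ := ih _ (length_lt hp.prop.2) p hp.prop.1 rfl
    refine hψ.exists_extension hφ h₀ hinj hC hp.prop.1 hπ hp.prop.2 fun x hx hxπ => ?_
    rcases relAnc_le_total hp.prop.1 hx with h | h
    · exact h.le
    · exact hp.le_of_ge ⟨hx, hxπ⟩ h

end Copy
-- Gluing the copy to the given bijection
theorem relAncTuple_extend (l : ℕ) {n : ℕ} (ρs : Fin n → NPT N) (ρ : NPT N) :
    relAncTuple l (extend ρs ρ) = relAncTuple l ρs ∪ relAnc l ρ := by
  ext x
  simp only [Set.mem_union, mem_relAncTuple, extend]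
  constructor
  · rintro ⟨i, hi⟩
    induction i using Fin.lastCases with
    | last => exact Or.inr (by simpa using hi)
    | cast i => exact Or.inl ⟨i, by simpa using hi⟩
  · rintro (⟨i, hi⟩ | hi)
    · exact ⟨i.castSucc, by simpa using hi⟩
    · exact ⟨Fin.last n, by simpa using hi⟩

theorem length_le_of_mem_relAncNil {l n C : ℕ} {ρs : Fin n → NPT N}
    (h : ∀ y ∈ relAncTuple l ρs, y.1.length ≤ C) {y : NPT N} (hy : y ∈ relAncNil l ρs) :
    y.1.length ≤ C := by
  rcases hy with rfl | hy
  · exact Nat.zero_le _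
  · exact h y hy

open Classical in
/-- Equivalent tuples can be extended, one of them by a given node and the other one by a node whose
relevant ancestors are short. -/
theorem AncEquiv.exists_extend [Finite Q] [Finite Γ] {l n C : ℕ} {ρs ρs' : Fin n → NPT N}
    (h : AncEquiv (4 * l + 5) ρs ρs')
    (hC : ∀ y ∈ relAncTuple (4 * l + 5) ρs', y.1.length ≤ C) (ρ : NPT N) :
    ∃ ρ' : NPT N, AncEquiv l (extend ρs ρ) (extend ρs' ρ') ∧
      ∀ y ∈ relAncTuple l (extend ρs' ρ'), y.1.length ≤
        C + (n * 4 ^ (3 * l + 3) + 2 + 4 ^ (l + 1)) * 2 ^ (2 + Nat.card (RunType Q Γ)) := by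
  -- Of the `4l + 5` levels, two are spent on making the bijection local and fixing the run of
  -- length zero; the remaining `4l + 3` cover `T = 3l + 3`.
  obtain ⟨φ, hφ', h₀, hinj'⟩ := AncEquiv.exists_isLocal_nil (l := 4 * l + 3) h
  obtain ⟨T, hT⟩ : ∃ T, T = 3 * l + 3 := ⟨_, rfl⟩
  rw [← hT]
  have hφ : IsLocal (relAncNil T ρs) φ := hφ'.mono (relAncNil_mono (by omega) _)
  have hinj : Set.InjOn φ (relAncNil (T + 1) ρs) := hinj'.mono (relAncNil_mono (by omega) _)
  have hCT : ∀ y ∈ relAncNil T ρs', y.1.length ≤ C := fun y hy =>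
    length_le_of_mem_relAncNil (fun z hz => hC z (relAncTuple_mono (by omega) _ hz)) hy
  obtain ⟨ψ, hψ⟩ := exists_isCopy hφ h₀ hinj hCT (l + 1) ρ
  have hsubT : relAncNil (l + 1) ρs ⊆ relAncNil T ρs := relAncNil_mono (by omega) _
  have hsubl : relAnc l ρ ⊆ relAnc (l + 1) ρ := relAnc_mono (Nat.le_succ l) ρ
  -- A node `z ≤ x` of the chain is within `2(l+1)` levels of `x`, and `x` is within `l+1` levels of
  -- the tuple: together `T`.
  have hold : ∀ x ∈ relAnc (l + 1) ρ, x ∈ relAncNil (l + 1) ρs → x ∈ oldAnc T (l + 1) ρs ρ :=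
    fun x hx hx' z hz hzx =>
      relAncNil_mono (by omega) _ (relAncNil_trans (relAnc_of_le hz hx hzx) hx')
  have hψloc : IsLocal (relAnc l ρ) ψ := by
    refine ⟨fun hy hxy => ?_, fun hy hxy => ?_, fun hy hxy => ?_, fun hy => ?_, fun hy => ?_⟩
    · exact hψ.edge _ _ (hxy.par.mem_relAnc hy) _ (hsubl hy) hxy
    · obtain ⟨z, δ, h1, h2, h3⟩ := jump_iff.1 hxy
      have hz := h1.par.mem_relAnc hy
      exact (hψ.edge _ _ hz _ (hsubl hy) h1).jump h2
        (hψ.plus _ (hxy.par.mem_relAnc hy) _ hz h3)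
    · exact hψ.plus _ (hxy.par.mem_relAnc hy) _ (hsubl hy) hxy
    · exact hψ.label _ (hsubl hy)
    · rw [hψ.agree _ (hsubl hy) (hold _ (hsubl hy) (nil_mem_relAncNil _ _)),
        hφ.nil (nil_mem_relAncNil _ _)]
  -- The same estimate on the other side: a copy close to the tuple `ρs'` would draw the fresh copy
  -- `ψ b` below it into the avoided set.
  have hnew : ∀ x ∈ relAnc (l + 1) ρ, x ∉ oldAnc T (l + 1) ρs ρ →
      ψ x ∉ relAncNil (l + 1) ρs' := by
    intro x hx hx' hmem
    obtain ⟨b, hb, hbx, hb'⟩ := hψ.fresh x hx hx'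
    have h1 := hψloc.mem_relAnc subset_rfl le_rfl hx
    have h2 := hψloc.mem_relAnc subset_rfl le_rfl hb
    have h3 : ψ b ≤ ψ x := by
      rcases hbx.eq_or_lt with rfl | hbx
      · exact le_rfl
      · exact (hψ.lt b hb x hx hbx).le
    exact hb' (relAncNil_mono (by omega) _ (relAncNil_trans (relAnc_of_le h2 h1 h3) hmem))
  set Ψ : NPT N → NPT N := fun x => if x ∈ relAncNil (l + 1) ρs then φ x else ψ x
  have hΨφ : ∀ x ∈ relAncNil (l + 1) ρs, Ψ x = φ x := fun x hx => if_pos hx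
  have hΨψ : ∀ x ∈ relAnc (l + 1) ρ, Ψ x = ψ x := fun x hx => by
    by_cases hx' : x ∈ relAncNil (l + 1) ρs
    · rw [hΨφ x hx', hψ.agree x hx (hold x hx hx')]
    · exact if_neg hx'
  have hsub1 : ∀ {k}, relAncTuple k ρs ⊆ relAncNil k ρs := fun h => Or.inr h
  have hsub2 : relAncNil l ρs ⊆ relAncNil (l + 1) ρs := relAncNil_mono (Nat.le_succ l) _
  have hΨloc : IsLocal (relAncTuple l (extend ρs ρ)) Ψ := by
    rw [relAncTuple_extend]
    refine ⟨?_, ?_, ?_, ?_, fun _ => ?_⟩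
    · rintro δ x y (hy | hy) hxy
      · rw [hΨφ y (hsub2 (hsub1 hy)), hΨφ x (hxy.par.mem_relAncNil (hsub1 hy))]
        exact hφ.edge (hsubT (hsub2 (hsub1 hy))) hxy
      · rw [hΨψ y (hsubl hy), hΨψ x (hxy.par.mem_relAnc hy)]
        exact hψloc.edge hy hxy
    · rintro x y (hy | hy) hxy
      · rw [hΨφ y (hsub2 (hsub1 hy)), hΨφ x (hxy.par.mem_relAncNil (hsub1 hy))]
        exact hφ.jump (hsubT (hsub2 (hsub1 hy))) hxy
      · rw [hΨψ y (hsubl hy), hΨψ x (hxy.par.mem_relAnc hy)]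
        exact hψloc.jump hy hxy
    · rintro x y (hy | hy) hxy
      · rw [hΨφ y (hsub2 (hsub1 hy)), hΨφ x (hxy.par.mem_relAncNil (hsub1 hy))]
        exact hφ.plus (hsubT (hsub2 (hsub1 hy))) hxy
      · rw [hΨψ y (hsubl hy), hΨψ x (hxy.par.mem_relAnc hy)]
        exact hψloc.plus hy hxy
    · rintro y (hy | hy)
      · rw [hΨφ y (hsub2 (hsub1 hy))]
        exact hφ.label (hsubT (hsub2 (hsub1 hy)))
      · rw [hΨψ y (hsubl hy)]
        exact hψloc.label hy
    · rw [hΨφ _ (nil_mem_relAncNil _ _), hφ.nil (nil_mem_relAncNil _ _)]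
  have hcross : ∀ x ∈ relAncNil (l + 1) ρs, ∀ y ∈ relAnc (l + 1) ρ, Ψ x = Ψ y → x = y := by
    intro x hx y hy hxy
    rw [hΨφ x hx, hΨψ y hy] at hxy
    -- For an old `y` both values come from the injective `φ`; for a new `y` its copy would be a
    -- relevant ancestor of `ρs'`.
    by_cases hyo : y ∈ oldAnc T (l + 1) ρs ρ
    · rw [hψ.agree y hy hyo] at hxy
      exact hinj (relAncNil_mono (by omega) _ hx)
        (relAncNil_mono (Nat.le_succ T) _ (hyo y hy le_rfl)) hxy
    · refine absurd ?_ (hnew y hy hyo)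
      rw [← hxy]
      exact hφ.mem_relAncNil h₀ (by omega) hx
  have hΨinj : Set.InjOn Ψ (relAncTuple (l + 1) (extend ρs ρ)) := by
    rw [relAncTuple_extend]
    rintro x (hx | hx) y (hy | hy) hxy
    · rw [hΨφ x (hsub1 hx), hΨφ y (hsub1 hy)] at hxy
      exact hinj (relAncNil_mono (by omega) _ (hsub1 hx)) (relAncNil_mono (by omega) _ (hsub1 hy))
        hxy
    · exact hcross x (hsub1 hx) y hy hxy
    · exact (hcross y (hsub1 hy) x hx hxy.symm).symm
    · rw [hΨψ x hx, hΨψ y hy] at hxy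
      rcases relAnc_le_total hy hx with h1 | h1
      · exact absurd hxy (hψ.lt x hx y hy h1).ne
      · rcases h1.eq_or_lt with h1 | h1
        · exact h1.symm
        · exact absurd hxy.symm (hψ.lt y hy x hx h1).ne
  refine ⟨ψ ρ, hΨloc.ancEquiv (fun i => ?_) hΨinj, fun y hy => ?_⟩
  · induction i using Fin.lastCases with
    | last => simpa [extend] using hΨψ ρ (self_mem_relAnc _ _)
    | cast i =>
      simpa [extend, h₀] using
        hΨφ (ρs i) (hsub1 (mem_relAncTuple.2 ⟨i, self_mem_relAnc _ _⟩))
  · rw [relAncTuple_extend] at hy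
    rcases hy with hy | hy
    · exact (hC y (relAncTuple_mono (by omega) _ hy)).trans (Nat.le_add_right _ _)
    · obtain ⟨x, hx, rfl⟩ := hψloc.exists_of_mem_relAnc subset_rfl (Nat.le_succ l) hy
      by_cases hxo : x ∈ oldAnc T (l + 1) ρs ρ
      · rw [hψ.agree x (hsubl hx) hxo]
        exact (hCT _ (hφ.mem_relAncNil h₀ (Nat.le_succ T) (hxo x (hsubl hx) le_rfl))).trans
          (Nat.le_add_right _ _)
      · exact (hψ.length x (hsubl hx) hxo).trans copyBound_le

end NPT

/-! ### Numerical bounds -/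

theorem two_pow_card_runType_le [Fintype Q] [Fintype Γ] (N : OnePS Q Γ) :
    (2 : ℝ) ^ (2 + Nat.card (RunType Q Γ)) ≤ Real.exp ((4 * N.size ^ 4 + 3 : ℕ) : ℝ) := by
  have h1 : 2 + Nat.card (RunType Q Γ) ≤ 4 * N.size ^ 4 + 3 := by
    have h2 := RunType.card_le (Q := Q) (Γ := Γ)
    have h3 : Fintype.card Q + Fintype.card Γ ≤ N.size := Nat.le_add_right _ _
    have := Nat.pow_le_pow_left h3 4
    omega
  have h2 : (2 : ℝ) ≤ Real.exp 1 := by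
    have := Real.add_one_le_exp (1 : ℝ)
    linarith
  calc (2 : ℝ) ^ (2 + Nat.card (RunType Q Γ)) ≤ 2 ^ (4 * N.size ^ 4 + 3) :=
        pow_le_pow_right₀ one_le_two h1
    _ ≤ Real.exp 1 ^ (4 * N.size ^ 4 + 3) := pow_le_pow_left₀ zero_le_two h2 _
    _ = _ := by rw [← Real.exp_nat_mul, mul_one]

theorem copy_count_le {l n : ℕ} (hn : 1 ≤ n) :
    n * 4 ^ (3 * l + 3) + 2 + 4 ^ (l + 1) ≤ 4 ^ l * n * 4 ^ (4 * l + 5) := by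
  have h1 : 4 ^ (l + 1) ≤ n * 4 ^ (3 * l + 3) :=
    (Nat.pow_le_pow_right four_pos (by omega)).trans (Nat.le_mul_of_pos_left _ hn)
  have h2 : 1 ≤ n * 4 ^ (3 * l + 3) := Nat.mul_pos hn (pow_pos four_pos _)
  have h3 : n * 4 ^ (3 * l + 3) * 4 ≤ 4 ^ l * n * 4 ^ (4 * l + 5) := by
    calc n * 4 ^ (3 * l + 3) * 4 = 1 * n * 4 ^ (3 * l + 4) := by ring
      _ ≤ 4 ^ l * n * 4 ^ (4 * l + 5) :=
        Nat.mul_le_mul (Nat.mul_le_mul_right _ (Nat.one_le_pow _ _ four_pos))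
          (Nat.pow_le_pow_right four_pos (by omega))
  omega

end NestedPushdown

theorem mainTheorem4 :
    ∃ p : Polynomial ℕ,
      ∀ (Q Γ : Type*) [Fintype Q] [Fintype Γ] (N : OnePS Q Γ) (l' C n : ℕ), 1 ≤ n →
      ∀ ρs ρs' : Fin n → NPT N,
        AncEquiv (4 * l' + 5) ρs ρs' →
        (∀ π ∈ relAncTuple (4 * l' + 5) ρs', π.1.length ≤ C) →
        ∀ ρ : NPT N, ∃ ρ' : NPT N,
          AncEquiv l' (extend ρs ρ) (extend ρs' ρ') ∧
          ∀ π ∈ relAncTuple l' (extend ρs' ρ'),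
            (π.1.length : ℝ) ≤
              C + 4 ^ l' * n * 4 ^ (4 * l' + 5) * Real.exp ((p.eval N.size : ℕ) : ℝ) := by
  -- The polynomial bounds `2` plus the number of run types, which is at most `4 * N.size ^ 4 + 1`;
  -- the base `2` is bounded by `e`.
  refine ⟨4 * .X ^ 4 + 3, fun Q Γ _ _ N l' C n hn ρs ρs' h hC ρ => ?_⟩
  obtain ⟨ρ', h1, h2⟩ := h.exists_extend hC ρ
  refine ⟨ρ', h1, fun π hπ => ?_⟩
  have h3 : (Polynomial.eval N.size (4 * .X ^ 4 + 3 : Polynomial ℕ)) = 4 * N.size ^ 4 + 3 := by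
    simp
  rw [h3]
  have h4 : (π.1.length : ℝ) ≤ C + ((n * 4 ^ (3 * l' + 3) + 2 + 4 ^ (l' + 1) : ℕ) : ℝ) *
      2 ^ (2 + Nat.card (RunType Q Γ)) := by
    exact_mod_cast h2 π hπ
  have h5 : ((n * 4 ^ (3 * l' + 3) + 2 + 4 ^ (l' + 1) : ℕ) : ℝ) ≤
      4 ^ l' * n * 4 ^ (4 * l' + 5) := by
    exact_mod_cast copy_count_le hn
  exact h4.trans (add_le_add_right
    (mul_le_mul h5 (two_pow_card_runType_le N) (by positivity) (by positivity)) _)
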